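/- **Setting.** Let $(A,P,\Pi,P^\vee,\Pi^\vee)$ be a Cartan datum: $A=(a_{ij})_{i,j\in I}$ is a generalized Cartan matrix symmetrized by positive integers $d_i$ ($d_ia_{ij}=d_ja_{ji}$), $P$ is a free abelian group of finite rank, and $\alpha_i\in P$ (linearly independent) and $\alpha_i^\vee\in P^\vee=\mathrm{Hom}(P,\mathbb Z)$ satisfy $\langle\alpha_i^\vee,\alpha_j\rangle=a_{ij}$; fundamental weights exist. Put $(\alpha_i,\alpha_j)=d_ia_{ij}$. Let $\mathbf k=\bigoplus_{m\ge 0}\mathbf k_m$ be a graded commutative ring (and $\mathbf k_m=0$ for $m<0$). Let $Q_{i,j}(u,v)\in\mathbf k[u,v]$ $(i,j\in I)$ satisfy $Q_{i,j}(u,v)=Q_{j,i}(v,u)$, $Q_{i,i}=0$ and, for $i\ne j$, $Q_{i,j}(u,v)=\sum_{p,q\ge0}c_{i,j,p,q}u^pv^q$ with $c_{i,j,p,q}\in\mathbf k_{-2(\alpha_i,\alpha_j)-(\alpha_i,\alpha_i)p-(\alpha_j,\alpha_j)q}$ and $c_{i,j,-a_{ij},0}\in\mathbf k_0^\times$. Let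 $\Lambda\in P$ be a dominant integral weight, and for each $i\in I$ let $a_i^\Lambda(u)=\sum_{r}c_{i;r}u^{\langle\alpha_i^\vee,\Lambda\rangle-r}$ be a monic polynomial of degree $\langle\alpha_i^\vee,\Lambda\rangle$ with $c_{i;r}\in\mathbf k_{r(\alpha_i,\alpha_i)}$. Let $n\ge1$, let $\beta=\sum_{j=1}^pk_j\alpha_{i_j}$ with $i_1,\dots,i_p\in I$ pairwise distinct, $k_j\ge 0$ and $\sum_jk_j=n$, and let $I^\beta=\{\nu\in I^n:\sum_r\alpha_{\nu_r}=\beta\}$, on which $\mathfrak S_n$ acts by $w.\nu=(\nu_{w^{-1}(1)},\dots,\nu_{w^{-1}(n)})$; $s_l$ is the transposition $(l,l+1)$. The Khovanov–Lauda–Rouquier algebra $\mathscr R_\beta$ is the associative unital $\mathbf k$-algebra with generators $e(\nu)$ $(\nu\in I^\beta)$, $x_1,\dots,x_n$, $\tau_1,\dots,\tau_{n-1}$ and relations $$e(\nu)e(\nu')=\delta_{\nu\nu'}e(\nu),\quad \sum_\nu e(\nu)=1,\quad x_rx_s=x_sx_r,\quad x_re(\nu)=e(\nu)x_r,\quad \tau_le(\nu)=e(s_l.\nu)\tau_l,$$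 $$\tau_l\tau_m=\tau_m\tau_l\ (|l-m|>1),\qquad \tau_l^2e(\nu)=Q_{\nu_l,\nu_{l+1}}(x_l,x_{l+1})e(\nu),$$ $$(\tau_lx_r-x_{s_l(r)}\tau_l)e(\nu)=\begin{cases}-e(\nu)& r=l,\ \nu_l=\nu_{l+1},\\ e(\nu)& r=l+1,\ \nu_l=\nu_{l+1},\\ 0&\text{otherwise,}\end{cases}$$ $$(\tau_{l+1}\tau_l\tau_{l+1}-\tau_l\tau_{l+1}\tau_l)e(\nu)=\begin{cases}\dfrac{Q_{\nu_l,\nu_{l+1}}(x_l,x_{l+1})-Q_{\nu_{l+2},\nu_{l+1}}(x_{l+2},x_{l+1})}{x_l-x_{l+2}}\,e(\nu)&\nu_l=\nu_{l+2},\\ 0&\text{otherwise.}\end{cases}$$ For every $w\in\mathfrak S_n$ fix a reduced expression $w=s_{l_1}\cdots s_{l_t}$ and put $\tau_w=\tau_{l_1}\cdots\tau_{l_t}$. Let $I_{\Lambda,\beta}$ be the two-sided ideal of $\mathscr R_\beta$ generated by $\sum_{\nu\in I^\beta}a^\Lambda_{\nu_1}(x_1)e(\nu)$. Regard $\mathscr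 R_\beta$ as a right $\mathbf k[x_1,\dots,x_n]$-module by right multiplication. Let $\widetilde\nu=(i_1,\dots,i_1,i_2,\dots,i_2,\dots,i_p,\dots,i_p)\in I^\beta$, with $k_j$ consecutive copies of $i_j$, and write $i_s\prec i_t$ if and only if $s<t$. For $f\in\mathbf k[x_1,\dots,x_n]$ let $s_l(f)$ be obtained from $f$ by exchanging $x_l$ and $x_{l+1}$, and put $\partial_l(f)=\frac{f-s_l(f)}{x_{l+1}-x_l}$. For all $\nu\in I^\beta$ define recursively $g^\Lambda_{\nu,1}=a^\Lambda_{\nu_1}(x_1)$ and, for $1\le k<n$, $$g^\Lambda_{\nu,k+1}=\begin{cases}\partial_k(g^\Lambda_{\nu,k})&\text{if }\nu_k=\nu_{k+1},\\ s_k(g^\Lambda_{s_k.\nu,k})&\text{if }\nu_k\succ\nu_{k+1},\\ s_k(g^\Lambda_{s_k.\nu,k})\,Q_{\nu_k,\nu_{k+1}}(x_k,x_{k+1})&\text{if }\nu_k\prec\nu_{k+1}.\end{cases}$$ **Theorem.** Let $\nu\in I^\beta$. 1. For every $1\le k\le n$ we have $g^\Lambda_{\nu,k}\in\mathbf k[x_1,\dots,x_k]$,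 and $g^\Lambda_{\nu,k}$ is monic in $x_k$ up to a unit, that is, as a polynomial in $x_k$ it has a leading coefficient in $\mathbf k_0$ that is invertible; the only possible exception is that $g^\Lambda_{\nu,k}=0$, and this happens only if $g^\Lambda_{\nu,j}$ is a constant that is a unit of $\mathbf k_0$ for some $j<k$. 2. As a right $\mathbf k[x_1,\dots,x_n]$-module, $e(\widetilde\nu)I_{\Lambda,\beta}e(\nu)$ is generated by the set $$\{\tau_wg^\Lambda_{\nu,k}e(\nu)\mid 1\le k\le n,\ w\in\mathfrak S_n,\ w.\nu=\widetilde\nu\}.$$ -/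

import Mathlib

noncomputable section

namespace QuiverHecke

universe uI uP uK

/-- A Cartan datum `(A, P, Π, P^∨, Π^∨)` with index set `I` and weight lattice `P`, together with
the positive integers `d i` that symmetrize `A`.  (That `P` is free of finite rank is expressed by
the instances `Module.Free ℤ P` and `Module.Finite ℤ P` where it is used.) -/
structure CartanDatum (I : Type uI) (P : Type uP) [DecidableEq I] [AddCommGroup P] where
  /-- the Cartan matrix -/
  A : I → I → ℤ
  A_diag : ∀ i, A i i = 2
  A_offDiag : ∀ i j, i ≠ j → A i j ≤ 0
  A_zero_iff : ∀ i j, A i j = 0 ↔ A j i = 0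
  /-- the entries of the symmetrizing diagonal matrix -/
  d : I → ℤ
  d_pos : ∀ i, 0 < d i
  symmetrizable : ∀ i j, d i * A i j = d j * A j i
  /-- the simple roots -/
  root : I → P
  /-- the simple coroots -/
  coroot : I → Module.Dual ℤ P
  coroot_root : ∀ i j, coroot i (root j) = A i j
  linearIndependent_root : LinearIndependent ℤ root
  exists_fundamental : ∀ i, ∃ ϖ : P, ∀ j, coroot j ϖ = if i = j then 1 else 0

variable {I : Type uI} {P : Type uP} [DecidableEq I] [AddCommGroup P]

/-- The value `(α_i, α_j) = d_i a_{ij}` of the symmetric bilinear form. -/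
def CartanDatum.form (D : CartanDatum I P) (i j : I) : ℤ := D.d i * D.A i j

/-- Dominant integral weights. -/
def CartanDatum.IsDominant (D : CartanDatum I P) (Λ : P) : Prop := ∀ i, 0 ≤ D.coroot i Λ

/-- The permutation action on sequences, `w.ν = (ν_{w⁻¹(1)}, …, ν_{w⁻¹(n)})`. -/
def permSeq {ι : Type*} {J : Type*} (w : Equiv.Perm ι) (ν : ι → J) : ι → J := fun r => ν (w⁻¹ r)

/-- The set `I^β` of sequences of length `N` whose simple roots add up to `β`. -/
def CartanDatum.Seq (D : CartanDatum I P) (N : ℕ) (β : P) : Type uI :=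
  {ν : Fin N → I // ∑ r, D.root (ν r) = β}

instance (D : CartanDatum I P) (N : ℕ) (β : P) : CoeFun (D.Seq N β) (fun _ => Fin N → I) :=
  ⟨Subtype.val⟩

instance [Finite I] (D : CartanDatum I P) (N : ℕ) (β : P) : Fintype (D.Seq N β) :=
  haveI : Finite (D.Seq N β) := Subtype.finite
  Fintype.ofFinite _

/-- The symmetric group acts on `I^β`. -/
def CartanDatum.Seq.act {D : CartanDatum I P} {N : ℕ} {β : P} (w : Equiv.Perm (Fin N))
    (ν : D.Seq N β) : D.Seq N β :=
  ⟨permSeq w ν, by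
    have h := Equiv.sum_comp w⁻¹ (fun r => D.root (ν r))
    exact h.trans ν.2⟩

variable {k : Type uK} [CommRing k]

/-- `c` is homogeneous of the integral degree `z` for the grading `𝒜` of `k` by natural numbers;
in negative degrees only `0` is homogeneous. -/
def HomogOfDeg (𝒜 : ℕ → AddSubgroup k) (z : ℤ) (c : k) : Prop :=
  c = 0 ∨ ∃ m : ℕ, (m : ℤ) = z ∧ c ∈ 𝒜 m

/-- The coefficient `c_{i,j,p,q}` of `u^p v^q` in `Q_{i,j}(u,v)`; the variable `u` has index `0` and
`v` has index `1`. -/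
def coeffQ (Q : I → I → MvPolynomial (Fin 2) k) (i j : I) (p q : ℕ) : k :=
  (Q i j).coeff (Finsupp.single 0 p + Finsupp.single 1 q)

/-- The conditions on the matrix `(Q_{i,j}(u,v))`. -/
structure IsQMatrix (D : CartanDatum I P) (𝒜 : ℕ → AddSubgroup k)
    (Q : I → I → MvPolynomial (Fin 2) k) : Prop where
  symm : ∀ i j, Q i j = MvPolynomial.rename (Equiv.swap 0 1) (Q j i)
  diag : ∀ i, Q i i = 0
  homog : ∀ i j, i ≠ j → ∀ p q : ℕ,
    HomogOfDeg 𝒜 (-2 * D.form i j - D.form i i * p - D.form j j * q) (coeffQ Q i j p q)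
  unit : ∀ i j, i ≠ j → coeffQ Q i j (-D.A i j).toNat 0 ∈ 𝒜 0 ∧
    IsUnit (coeffQ Q i j (-D.A i j).toNat 0)

/-- The conditions on the polynomials `a_i^Λ(u) = ∑_r c_{i;r} u^{⟨α_i^∨, Λ⟩ - r}`. -/
structure IsCyclotomicFamily (D : CartanDatum I P) (𝒜 : ℕ → AddSubgroup k) (Λ : P)
    (a : I → Polynomial k) : Prop where
  monic : ∀ i, (a i).IsMonicOfDegree (D.coroot i Λ).toNat
  homog : ∀ i, ∀ r ≤ (D.coroot i Λ).toNat,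
    HomogOfDeg 𝒜 (r * D.form i i) ((a i).coeff ((D.coroot i Λ).toNat - r))

section Polynomials

open MvPolynomial
open scoped IsMulCommutative

/-- The exact quotient `f / g` (zero if `g` does not divide `f`). -/
def exactDiv {σ : Type*} (f g : MvPolynomial σ k) : MvPolynomial σ k :=
  open Classical in if h : g ∣ f then h.choose else 0

theorem mul_exactDiv {σ : Type*} {f g : MvPolynomial σ k} (h : g ∣ f) : g * exactDiv f g = f := by
  rw [exactDiv, dif_pos h]
  exact h.choose_spec.symm

theorem X_sub_X_dvd {σ : Type*} [DecidableEq σ] (r s : σ) (f : MvPolynomial σ k) :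
    (X r - X s : MvPolynomial σ k) ∣ f - rename (Equiv.swap r s) f := by
  induction f using MvPolynomial.induction_on with
  | C c => simp
  | add p q hp hq =>
    rw [map_add, add_sub_add_comm]
    exact dvd_add hp hq
  | mul_X p t hp =>
    rw [map_mul, rename_X]
    have e : p * X t - rename (Equiv.swap r s) p * X (Equiv.swap r s t) =
        (p - rename (Equiv.swap r s) p) * X t +
          rename (Equiv.swap r s) p * (X t - X (Equiv.swap r s t)) := by ring
    rw [e]
    refine dvd_add (Dvd.dvd.mul_right hp _) (Dvd.dvd.mul_left ?_ _)
    by_cases h1 : t = r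
    · subst h1; simp
    by_cases h2 : t = s
    · subst h2
      rw [Equiv.swap_apply_right, ← neg_sub]
      exact (neg_dvd (α := MvPolynomial σ k)).mpr (dvd_refl _)
    · rw [Equiv.swap_apply_of_ne_of_ne h1 h2]; simp

/-- The simple transposition exchanging the (adjacent) positions `l` and `l + 1`. -/
def simpleSwap {n : ℕ} (l : Fin n) : Equiv.Perm (Fin (n + 1)) := Equiv.swap l.castSucc l.succ

/-- The action of `s_l` on polynomials. -/
def sPoly {n : ℕ} (l : Fin n) (f : MvPolynomial (Fin (n + 1)) k) : MvPolynomial (Fin (n + 1)) k :=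
  rename (simpleSwap l) f

/-- The Demazure operator `∂_l(f) = (f - s_l(f)) / (x_{l+1} - x_l)`. -/
def demazure {n : ℕ} (l : Fin n) (f : MvPolynomial (Fin (n + 1)) k) :
    MvPolynomial (Fin (n + 1)) k :=
  exactDiv (f - sPoly l f) (X l.succ - X l.castSucc)

theorem mul_demazure {n : ℕ} (l : Fin n) (f : MvPolynomial (Fin (n + 1)) k) :
    (X l.succ - X l.castSucc) * demazure l f = f - sPoly l f := by
  refine mul_exactDiv ?_
  have h := X_sub_X_dvd l.succ l.castSucc f
  rwa [Equiv.swap_comm] at h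

/-- The polynomial `Q_{i,j}(x_r, x_s)`. -/
def evalQ {J : Type*} {σ : Type*} (Q : J → J → MvPolynomial (Fin 2) k) (i j : J) (r s : σ) :
    MvPolynomial σ k :=
  aeval ![X r, X s] (Q i j)

/-- The polynomial `(Q_{i,j}(x_r, x_s) - Q_{i,j}(x_t, x_s)) / (x_r - x_t)`. -/
def braidPoly {J : Type*} {σ : Type*} (Q : J → J → MvPolynomial (Fin 2) k) (i j : J) (r s t : σ) :
    MvPolynomial σ k :=
  exactDiv (evalQ Q i j r s - evalQ Q i j t s) (X r - X t)

theorem mul_braidPoly {J : Type*} {σ : Type*} [DecidableEq σ]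
    (Q : J → J → MvPolynomial (Fin 2) k) (i j : J)
    {r s t : σ} (hr : s ≠ r) (ht : s ≠ t) :
    (X r - X t) * braidPoly Q i j r s t = evalQ Q i j r s - evalQ Q i j t s := by
  refine mul_exactDiv ?_
  have h := X_sub_X_dvd r t (evalQ Q i j r s)
  have e : rename (Equiv.swap r t) (evalQ Q i j r s) = evalQ Q i j t s := by
    rw [evalQ, evalQ, ← AlgHom.comp_apply, comp_aeval]
    refine congrArg (fun v : Fin 2 → MvPolynomial σ k => aeval v (Q i j)) ?_
    funext u
    fin_cases u
    · simp
    · simp [Equiv.swap_apply_of_ne_of_ne hr ht]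
  rwa [e] at h

/-- The generators `e(ν)`, `x_r`, `τ_l` of the KLR algebra; for a `β` of height `n + 1` the indices
of the `x` range over `Fin (n + 1)` and those of the `τ` over `Fin n`. -/
inductive Gen (D : CartanDatum I P) (n : ℕ) (β : P) : Type uI
  | e (ν : D.Seq (n + 1) β)
  | x (r : Fin (n + 1))
  | tau (l : Fin n)

variable (k) in
/-- The free algebra on the KLR generators. -/
abbrev FreeKLR (D : CartanDatum I P) (n : ℕ) (β : P) := FreeAlgebra k (Gen D n β)

namespace FreeKLR

variable {D : CartanDatum I P} {n : ℕ} {β : P}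

variable (k) in
/-- The generator `e(ν)`. -/
def e (ν : D.Seq (n + 1) β) : FreeKLR k D n β := FreeAlgebra.ι k (Gen.e ν)

variable (k D β) in
/-- The generator `x_r`. -/
def x (r : Fin (n + 1)) : FreeKLR k D n β := FreeAlgebra.ι k (Gen.x r)

variable (k D β) in
/-- The generator `τ_l`. -/
def tau (l : Fin n) : FreeKLR k D n β := FreeAlgebra.ι k (Gen.tau l)

variable (D β) in
/-- A polynomial in `x_1, …, x_{n+1}` written in the free algebra, through the ordered monomials
`x_1^{a_1} ⋯ x_{n+1}^{a_{n+1}}`. -/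
def poly (f : MvPolynomial (Fin (n + 1)) k) : FreeKLR k D n β :=
  ∑ m ∈ f.support, f.coeff m • (List.ofFn fun r => x k D β r ^ m r).prod

end FreeKLR

open FreeKLR in
/-- The defining relations of the KLR algebra. -/
inductive Rel [Finite I] (D : CartanDatum I P) (Q : I → I → MvPolynomial (Fin 2) k) (n : ℕ)
    (β : P) : FreeKLR k D n β → FreeKLR k D n β → Prop
  | e_mul_self (ν : D.Seq (n + 1) β) : Rel D Q n β (e k ν * e k ν) (e k ν)
  | e_mul_e (ν ν' : D.Seq (n + 1) β) (h : ν ≠ ν') : Rel D Q n β (e k ν * e k ν') 0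
  | sum_e : Rel D Q n β (∑ ν : D.Seq (n + 1) β, e k ν) 1
  | x_mul_x (r s : Fin (n + 1)) :
      Rel D Q n β (x k D β r * x k D β s) (x k D β s * x k D β r)
  | x_mul_e (r : Fin (n + 1)) (ν : D.Seq (n + 1) β) :
      Rel D Q n β (x k D β r * e k ν) (e k ν * x k D β r)
  | tau_mul_e (l : Fin n) (ν : D.Seq (n + 1) β) :
      Rel D Q n β (tau k D β l * e k ν) (e k (ν.act (simpleSwap l)) * tau k D β l)
  | tau_mul_tau (l l' : Fin n) (h : (l : ℕ) + 1 < l') :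
      Rel D Q n β (tau k D β l * tau k D β l') (tau k D β l' * tau k D β l)
  | tau_sq (l : Fin n) (ν : D.Seq (n + 1) β) :
      Rel D Q n β (tau k D β l ^ 2 * e k ν)
        (poly D β (evalQ Q (ν l.castSucc) (ν l.succ) l.castSucc l.succ) * e k ν)
  | tau_x (l : Fin n) (r : Fin (n + 1)) (ν : D.Seq (n + 1) β) :
      Rel D Q n β ((tau k D β l * x k D β r - x k D β (simpleSwap l r) * tau k D β l) * e k ν)
        (if r = l.castSucc ∧ ν l.castSucc = ν l.succ then -e k ν
          else if r = l.succ ∧ ν l.castSucc = ν l.succ then e k ν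
          else 0)
  | braid (l l' : Fin n) (h : (l' : ℕ) = l + 1) (ν : D.Seq (n + 1) β) :
      Rel D Q n β
        ((tau k D β l' * tau k D β l * tau k D β l' - tau k D β l * tau k D β l' * tau k D β l)
          * e k ν)
        (if ν l.castSucc = ν l'.succ then
          poly D β (braidPoly Q (ν l.castSucc) (ν l.succ) l.castSucc l.succ l'.succ) * e k ν
          else 0)

/-- The Khovanov-Lauda-Rouquier algebra `R_β` for `β` of height `n + 1`. -/
def KLRAlgebra [Finite I] (D : CartanDatum I P) (Q : I → I → MvPolynomial (Fin 2) k) (n : ℕ)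
    (β : P) : Type (max uI uK) :=
  RingQuot (Rel D Q n β)

namespace KLRAlgebra

variable [Finite I] (D : CartanDatum I P) (Q : I → I → MvPolynomial (Fin 2) k) {n : ℕ} (β : P)

instance : Ring (KLRAlgebra D Q n β) := inferInstanceAs (Ring (RingQuot (Rel D Q n β)))

instance : Algebra k (KLRAlgebra D Q n β) := inferInstanceAs (Algebra k (RingQuot (Rel D Q n β)))

/-- The quotient map from the free algebra. -/
def mk : FreeKLR k D n β →ₐ[k] KLRAlgebra D Q n β := RingQuot.mkAlgHom k (Rel D Q n β)

/-- The idempotent `e(ν)`. -/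
def e {β : P} (ν : D.Seq (n + 1) β) : KLRAlgebra D Q n β := mk D Q β (FreeKLR.e k ν)

/-- The element `x_r`. -/
def x (r : Fin (n + 1)) : KLRAlgebra D Q n β := mk D Q β (FreeKLR.x k D β r)

/-- The element `τ_l`. -/
def tau (l : Fin n) : KLRAlgebra D Q n β := mk D Q β (FreeKLR.tau k D β l)

theorem x_mul_x (r s : Fin (n + 1)) : x D Q β r * x D Q β s = x D Q β s * x D Q β r := by
  have h := RingQuot.mkAlgHom_rel k (Rel.x_mul_x (D := D) (Q := Q) (n := n) (β := β) r s)
  rw [map_mul, map_mul] at h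
  exact h

theorem range_comm : ∀ y ∈ Set.range (x D Q β (n := n)), ∀ z ∈ Set.range (x D Q β (n := n)),
    y * z = z * y := by
  rintro _ ⟨r, rfl⟩ _ ⟨s, rfl⟩
  exact x_mul_x D Q β r s

/-- The homomorphism `k[x_1, …, x_{n+1}] → R_β` sending each variable `x_r` to the generator
`x_r`. -/
def ofPoly : MvPolynomial (Fin (n + 1)) k →ₐ[k] KLRAlgebra D Q n β :=
  haveI : IsMulCommutative (Algebra.adjoin k (Set.range (x D Q β (n := n)))) :=
    Algebra.isMulCommutative_adjoin k (range_comm D Q β)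
  (Algebra.adjoin k (Set.range (x D Q β (n := n)))).val.comp
    (aeval (S₁ := Algebra.adjoin k (Set.range (x D Q β (n := n))))
      fun r => ⟨x D Q β r, Algebra.subset_adjoin ⟨r, rfl⟩⟩)

@[simp]
theorem ofPoly_X (r : Fin (n + 1)) : ofPoly D Q β (X r) = x D Q β r := by
  simp [ofPoly]

theorem mk_poly (f : MvPolynomial (Fin (n + 1)) k) :
    mk D Q β (FreeKLR.poly D β f) = ofPoly D Q β f := by
  conv_rhs => rw [f.as_sum]
  rw [FreeKLR.poly, map_sum, map_sum]
  refine Finset.sum_congr rfl fun m _ => ?_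
  have e1 : (monomial m (f.coeff m) : MvPolynomial (Fin (n + 1)) k) =
      f.coeff m • (List.ofFn fun r => (X r : MvPolynomial (Fin (n + 1)) k) ^ m r).prod := by
    rw [List.prod_ofFn, monomial_eq, Finsupp.prod_fintype _ _ (by simp), smul_eq_C_mul]
  rw [e1, map_smul, map_smul, map_list_prod, map_list_prod, List.map_ofFn, List.map_ofFn]
  congr 3
  funext r
  simp only [Function.comp_apply, map_pow, ofPoly_X]
  rfl

/-- `R_β` is a right module over `k[x_1, …, x_{n+1}]` by right multiplication; a right module is a
left module over the opposite ring. -/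
instance : Module (MvPolynomial (Fin (n + 1)) k)ᵐᵒᵖ (KLRAlgebra D Q n β) :=
  Module.compHom (KLRAlgebra D Q n β) (RingHom.op (ofPoly D Q β (n := n)).toRingHom)

theorem op_smul (f : MvPolynomial (Fin (n + 1)) k) (y : KLRAlgebra D Q n β) :
    MulOpposite.op f • y = y * ofPoly D Q β f := rfl

/-- The product `τ_{l_1} τ_{l_2} ⋯ τ_{l_r}` for a word `l_1 l_2 ⋯ l_r`. -/
def tauWord (L : List (Fin n)) : KLRAlgebra D Q n β := (L.map (tau D Q β)).prod

/-- The two-sided ideal `I_{Λ,β} = R_β a_β^Λ(x_1) R_β`, where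
`a_β^Λ(x_1) = ∑_ν a_{ν_1}^Λ(x_1) e(ν)`. -/
def cyclotomicIdeal (a : I → Polynomial k) : TwoSidedIdeal (KLRAlgebra D Q n β) :=
  TwoSidedIdeal.span
    {∑ ν : D.Seq (n + 1) β, Polynomial.aeval (x D Q β (0 : Fin (n + 1))) (a (ν 0)) * e D Q ν}

end KLRAlgebra

/-- `L` is a reduced word for the permutation `w`. -/
def IsReducedWord {n : ℕ} (L : List (Fin n)) (w : Equiv.Perm (Fin (n + 1))) : Prop :=
  (L.map simpleSwap).prod = w ∧
    ∀ L' : List (Fin n), (L'.map simpleSwap).prod = w → L.length ≤ L'.length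

/-- The order `i_s ≺ i_t ↔ s < t` on the colours `i_1, …, i_p`, listed by `c`. -/
def Prec {p : ℕ} (c : Fin p → I) (i j : I) : Prop := ∃ s t : Fin p, c s = i ∧ c t = j ∧ s < t

/-- `ν` is the sequence consisting of `mult 1` copies of `c 1`, followed by `mult 2` copies of
`c 2`, and so on. -/
def IsBlockSequence {p N : ℕ} (c : Fin p → I) (mult : Fin p → ℕ) (ν : Fin N → I) : Prop :=
  List.ofFn ν = (List.finRange p).flatMap fun s => List.replicate (mult s) (c s)

/-- The polynomials `g_{ν,r}^Λ`, by recursion on `r` (for all `ν` at the same time). -/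
def gPoly (Q : I → I → MvPolynomial (Fin 2) k) (a : I → Polynomial k) {p : ℕ} (c : Fin p → I)
    {n : ℕ} (r : Fin (n + 1)) : (Fin (n + 1) → I) → MvPolynomial (Fin (n + 1)) k :=
  Fin.induction (motive := fun _ => (Fin (n + 1) → I) → MvPolynomial (Fin (n + 1)) k)
    (fun ν => Polynomial.aeval (X 0) (a (ν 0)))
    (fun l g ν =>
      open Classical in
      if ν l.castSucc = ν l.succ then demazure l (g ν)
      else if Prec c (ν l.succ) (ν l.castSucc) then sPoly l (g (permSeq (simpleSwap l) ν))
      else sPoly l (g (permSeq (simpleSwap l) ν)) *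
        evalQ Q (ν l.castSucc) (ν l.succ) l.castSucc l.succ)
    r

/-- Seen as a polynomial in `x_r`, the polynomial `f` has a leading coefficient which lies in
`k_0` and is invertible. -/
def HasUnitLeadingCoeff (𝒜 : ℕ → AddSubgroup k) {σ : Type*} (r : σ) (f : MvPolynomial σ k) : Prop :=
  ∃ (N : ℕ) (u : k) (h : MvPolynomial σ k), u ∈ 𝒜 0 ∧ IsUnit u ∧
    (∀ m ∈ h.support, m r < N) ∧ f = C u * X r ^ N + h

end Polynomials

end QuiverHecke

end

open QuiverHecke

noncomputable section

namespace QuiverHecke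

/-! ### Length, reduced words and descents in the symmetric group -/

section Inversions

variable {n : ℕ}

/-! Part 1 is an induction on k. The grading makes `Q i j`, as a polynomial in its second variable,
have an invertible leading coefficient in degree zero (`IsQMatrix.hasUnitLeadingCoeff`). A swap
carries the leading term in x_k to one in x_{k+1}, and a Demazure operator lowers the degree by one
and changes the sign of the leading coefficient, unless the polynomial is a unit constant, which it
kills. This gives `gPoly_leadingCoeff`.

For part 2, write L_r for the span of all e(ν') y g_{μ,r} e(μ), with y and μ arbitrary
(`levelSpan`), and L_{≤r} for the sum of the L_s with s ≤ r (`lowerSpan`). Since g_{μ,1} e(μ) is the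
cyclotomic generator times e(μ), the task is to show that L_{≤n} is a right ideal and that it stays
inside the cyclotomic ideal. The latter follows from L_{l+1} ⊆ L_l + L_l τ_l
(`levelSpan_succ_decomp`). For the former, L_l τ_l and L_{l+1} τ_l lie in L_{≤l+1}, and L_r τ_l lies
in L_r when r < l. The remaining products, of L_r by τ_l with l + 1 < r, are reduced to these by the
decomposition together with the commutation and braid relations (`lowerSpan_mul_tau`).

The recursion for g is built to make these inclusions hold. For equal neighbouring colours, τ_l g -
s_l(g) τ_l = ∂_l(g) on e(ν), and τ_l² e(ν) = 0. For different colours τ_l intertwines g and s_l(g),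
at the price of a factor Q whenever τ_l² appears. The order of the colours decides when that factor
can be avoided: as ν' is sorted, any w with w.ν = ν' has a descent at l if ν_l ≻ ν_{l+1}, so e(ν') R
e(ν) = e(ν') R τ_l e(ν) (`exists_tau_factor`).

Finally, R is spanned by products of some τ_w and an element of the commutative subalgebra of the
x_r and e(ν), for any choice of reduced words (`mem_span_reducedWords`). This turns the arbitrary y
in L_{≤n} e(ν) into elements τ_w with polynomial coefficients, which can be moved to the right of g.
Only spanning is needed, not linear independence of the τ_w; it rests on Matsumoto's theorem
(`IsReducedWord.rel`). -/

theorem simpleSwap_mul_self (l : Fin n) : simpleSwap l * simpleSwap l = 1 :=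
  Equiv.swap_mul_self _ _

theorem simpleSwap_castSucc (l : Fin n) : simpleSwap l l.castSucc = l.succ :=
  Equiv.swap_apply_left _ _

theorem simpleSwap_succ (l : Fin n) : simpleSwap l l.succ = l.castSucc :=
  Equiv.swap_apply_right _ _

theorem simpleSwap_inv (l : Fin n) : (simpleSwap l)⁻¹ = simpleSwap l :=
  Equiv.swap_inv _ _

theorem simpleSwap_simpleSwap (l : Fin n) (i : Fin (n + 1)) :
    simpleSwap l (simpleSwap l i) = i := Equiv.swap_apply_self _ _ _

theorem simpleSwap_of_ne {l : Fin n} {i : Fin (n + 1)} (h1 : i ≠ l.castSucc) (h2 : i ≠ l.succ) :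
    simpleSwap l i = i := Equiv.swap_apply_of_ne_of_ne h1 h2

theorem simpleSwap_lt_simpleSwap {l : Fin n} {i j : Fin (n + 1)} (hij : i < j)
    (h : ¬(i = l.castSucc ∧ j = l.succ)) : simpleSwap l i < simpleSwap l j := by
  unfold simpleSwap
  rw [Equiv.swap_apply_def, Equiv.swap_apply_def]
  simp only [Fin.ext_iff, Fin.lt_def, Fin.val_castSucc, Fin.val_succ] at *
  split_ifs <;> (try simp only [Fin.val_castSucc, Fin.val_succ]) <;> omega

/-- The set of inversions of a permutation. -/
def inversions (w : Equiv.Perm (Fin (n + 1))) : Finset (Fin (n + 1) × Fin (n + 1)) :=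
  {p | p.1 < p.2 ∧ w p.2 < w p.1}

/-- The number of inversions of a permutation. -/
def invCount (w : Equiv.Perm (Fin (n + 1))) : ℕ := (inversions w).card

theorem mem_inversions {w : Equiv.Perm (Fin (n + 1))} {p : Fin (n + 1) × Fin (n + 1)} :
    p ∈ inversions w ↔ p.1 < p.2 ∧ w p.2 < w p.1 := by simp [inversions]

theorem invCount_one : invCount (1 : Equiv.Perm (Fin (n + 1))) = 0 := by
  rw [invCount, Finset.card_eq_zero, Finset.eq_empty_iff_forall_notMem]
  intro p hp
  rw [mem_inversions] at hp
  exact lt_asymm hp.1 hp.2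

/-- With its counterpart for descents, this identifies the inversion number with word length, so
that being the last letter of some reduced word becomes the inequality w(l+1) < w(l). -/
theorem invCount_mul_of_lt {w : Equiv.Perm (Fin (n + 1))} {l : Fin n}
    (h : w l.castSucc < w l.succ) : invCount (w * simpleSwap l) = invCount w + 1 := by
  -- Adjacency matters: (l, l+1) is the only pair whose order is reversed by s_l, so every other
  -- inversion is merely relabelled.
  have key : inversions (w * simpleSwap l) = insert (l.castSucc, l.succ)
      ((inversions w).map (Equiv.prodCongr (simpleSwap l) (simpleSwap l)).toEmbedding) := by
    ext ⟨i, j⟩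
    simp only [mem_inversions, Equiv.Perm.mul_apply, Finset.mem_insert, Finset.mem_map,
      Prod.mk.injEq, Equiv.coe_toEmbedding, Equiv.prodCongr_apply, Prod.exists, Prod.map_apply]
    constructor
    · rintro ⟨hij, hw⟩
      by_cases h0 : i = l.castSucc ∧ j = l.succ
      · exact Or.inl h0
      · exact Or.inr ⟨simpleSwap l i, simpleSwap l j, ⟨simpleSwap_lt_simpleSwap hij h0, hw⟩,
          simpleSwap_simpleSwap _ _, simpleSwap_simpleSwap _ _⟩
    · rintro (⟨rfl, rfl⟩ | ⟨i', j', ⟨hij, hw⟩, rfl, rfl⟩)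
      · rw [simpleSwap_castSucc, simpleSwap_succ]
        exact ⟨Fin.castSucc_lt_succ, h⟩
      · rw [simpleSwap_simpleSwap, simpleSwap_simpleSwap]
        refine ⟨simpleSwap_lt_simpleSwap hij ?_, hw⟩
        rintro ⟨rfl, rfl⟩
        exact lt_asymm h hw
  rw [invCount, key, Finset.card_insert_of_notMem, Finset.card_map, invCount]
  simp only [mem_inversions, Finset.mem_map, Prod.mk.injEq, Equiv.coe_toEmbedding,
    Equiv.prodCongr_apply, Prod.exists, Prod.map_apply]
  rintro ⟨i, j, ⟨hij, -⟩, hi, hj⟩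
  rw [← simpleSwap_simpleSwap l i, hi, ← simpleSwap_simpleSwap l j, hj, simpleSwap_castSucc,
    simpleSwap_succ] at hij
  exact lt_asymm hij Fin.castSucc_lt_succ

theorem mul_simpleSwap_cancel (w : Equiv.Perm (Fin (n + 1))) (l : Fin n) :
    w * simpleSwap l * simpleSwap l = w := by
  rw [mul_assoc, simpleSwap_mul_self, mul_one]

theorem invCount_mul_of_gt {w : Equiv.Perm (Fin (n + 1))} {l : Fin n}
    (h : w l.succ < w l.castSucc) : invCount (w * simpleSwap l) + 1 = invCount w := by
  have h' : (w * simpleSwap l) l.castSucc < (w * simpleSwap l) l.succ := by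
    simpa [simpleSwap_castSucc, simpleSwap_succ] using h
  rw [← invCount_mul_of_lt h', mul_simpleSwap_cancel]

theorem apply_lt_or_gt (w : Equiv.Perm (Fin (n + 1))) (l : Fin n) :
    w l.castSucc < w l.succ ∨ w l.succ < w l.castSucc :=
  lt_or_gt_of_ne (w.injective.ne Fin.castSucc_lt_succ.ne)

theorem eq_one_of_forall_lt {w : Equiv.Perm (Fin (n + 1))}
    (h : ∀ l : Fin n, w l.castSucc < w l.succ) : w = 1 := by
  have hm : StrictMono w := Fin.strictMono_iff_lt_succ.2 h
  have := Subsingleton.elim (StrictMono.orderIsoOfSurjective w hm w.surjective) (OrderIso.refl _)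
  ext i
  have h2 := congrArg (fun e : Fin (n + 1) ≃o Fin (n + 1) => e i) this
  simpa using congrArg Fin.val h2

theorem exists_word_length_eq (w : Equiv.Perm (Fin (n + 1))) :
    ∃ L : List (Fin n), (L.map simpleSwap).prod = w ∧ L.length = invCount w := by
  induction hm : invCount w generalizing w with
  | zero =>
    refine ⟨[], ?_, rfl⟩
    symm
    refine eq_one_of_forall_lt fun l => (apply_lt_or_gt w l).resolve_right fun hl => ?_
    have := invCount_mul_of_gt hl
    omega
  | succ m ih =>
    by_cases hex : ∃ l : Fin n, w l.succ < w l.castSucc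
    · obtain ⟨l, hl⟩ := hex
      have h1 := invCount_mul_of_gt hl
      obtain ⟨L, hL, hlen⟩ := ih (w * simpleSwap l) (by omega)
      refine ⟨L ++ [l], ?_, by simp [hlen]⟩
      simp [hL, mul_simpleSwap_cancel]
    · have : w = 1 := eq_one_of_forall_lt fun l =>
        (apply_lt_or_gt w l).resolve_right fun hl => hex ⟨l, hl⟩
      rw [this, invCount_one] at hm
      omega

theorem invCount_mul_le (w : Equiv.Perm (Fin (n + 1))) (l : Fin n) :
    invCount (w * simpleSwap l) ≤ invCount w + 1 := by
  rcases apply_lt_or_gt w l with h | h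
  · exact (invCount_mul_of_lt h).le
  · have := invCount_mul_of_gt h
    omega

theorem prod_map_append_singleton (L : List (Fin n)) (l : Fin n) :
    ((L ++ [l]).map simpleSwap).prod = (L.map simpleSwap).prod * simpleSwap l := by
  simp

theorem invCount_prod_le (L : List (Fin n)) : invCount (L.map simpleSwap).prod ≤ L.length := by
  induction L using List.reverseRecOn with
  | nil => simp [invCount_one]
  | append_singleton L l ih =>
    rw [prod_map_append_singleton, List.length_append, List.length_singleton]
    exact (invCount_mul_le _ _).trans (by omega)

theorem isReducedWord_iff {L : List (Fin n)} {w : Equiv.Perm (Fin (n + 1))} :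
    IsReducedWord L w ↔ (L.map simpleSwap).prod = w ∧ L.length = invCount w := by
  refine and_congr_right fun hL => ⟨fun h => ?_, fun h L' hL' => ?_⟩
  · obtain ⟨L', h1, h2⟩ := exists_word_length_eq w
    refine le_antisymm (h2 ▸ h L' h1) (hL ▸ invCount_prod_le L)
  · rw [h, ← hL']
    exact invCount_prod_le L'

theorem exists_isReducedWord (w : Equiv.Perm (Fin (n + 1))) :
    ∃ L : List (Fin n), IsReducedWord L w := by
  simpa only [isReducedWord_iff] using exists_word_length_eq w

theorem IsReducedWord.append {L : List (Fin n)} {w : Equiv.Perm (Fin (n + 1))}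
    (hL : IsReducedWord L w) {l : Fin n} (h : w l.castSucc < w l.succ) :
    IsReducedWord (L ++ [l]) (w * simpleSwap l) := by
  rw [isReducedWord_iff] at hL ⊢
  rw [prod_map_append_singleton, hL.1, invCount_mul_of_lt h, List.length_append, hL.2]
  exact ⟨rfl, rfl⟩

theorem IsReducedWord.append_of_gt {L : List (Fin n)} {w : Equiv.Perm (Fin (n + 1))} {l : Fin n}
    (h : w l.succ < w l.castSucc) (hL : IsReducedWord L (w * simpleSwap l)) :
    IsReducedWord (L ++ [l]) w := by
  have := hL.append (l := l) (by simpa [simpleSwap_castSucc, simpleSwap_succ] using h)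
  rwa [mul_simpleSwap_cancel] at this

theorem IsReducedWord.of_append {L : List (Fin n)} {w : Equiv.Perm (Fin (n + 1))} {l : Fin n}
    (hL : IsReducedWord (L ++ [l]) w) :
    IsReducedWord L (w * simpleSwap l) ∧ w l.succ < w l.castSucc := by
  rw [isReducedWord_iff, prod_map_append_singleton, List.length_append,
    List.length_singleton] at hL
  rw [isReducedWord_iff]
  have h1 : (L.map simpleSwap).prod = w * simpleSwap l := by
    rw [← hL.1, mul_simpleSwap_cancel]
  have h2 := invCount_prod_le L
  rw [h1] at h2
  rcases apply_lt_or_gt w l with h | h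
  · have := invCount_mul_of_lt h
    omega
  · have := invCount_mul_of_gt h
    exact ⟨⟨h1, by omega⟩, h⟩

theorem simpleSwap_comm {s t : Fin n} (h : (s : ℕ) + 1 < t) :
    simpleSwap s * simpleSwap t = simpleSwap t * simpleSwap s := by
  refine (Equiv.Perm.Disjoint.commute ?_).eq
  intro i
  by_cases h1 : i = s.castSucc ∨ i = s.succ
  · right
    refine simpleSwap_of_ne ?_ ?_ <;> rintro rfl <;>
      simp only [Fin.ext_iff, Fin.val_castSucc, Fin.val_succ] at h1 <;> omega
  · left
    push Not at h1
    exact simpleSwap_of_ne h1.1 h1.2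

theorem simpleSwap_braid {s t : Fin n} (h : (t : ℕ) = s + 1) :
    simpleSwap s * simpleSwap t * simpleSwap s = simpleSwap t * simpleSwap s * simpleSwap t := by
  have e : s.succ = t.castSucc := by ext; simp [h]
  have h1 : s.castSucc ≠ t.castSucc := by simp [Fin.ext_iff]; omega
  have h2 : s.castSucc ≠ t.succ := by simp [Fin.ext_iff]; omega
  have h3 : t.castSucc ≠ t.succ := Fin.castSucc_lt_succ.ne
  have e1 := Equiv.swap_mul_swap_mul_swap h1 h2
  have e2 := Equiv.swap_mul_swap_mul_swap h3.symm h2.symm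
  rw [Equiv.swap_comm t.castSucc s.castSucc, Equiv.swap_comm t.succ t.castSucc] at e2
  unfold simpleSwap
  rw [e, e1, e2, Equiv.swap_comm]

/-- **Matsumoto's theorem** for the symmetric group: two reduced words of the same permutation are
related by every equivalence relation that is compatible with appending letters and contains the
braid moves. -/
theorem IsReducedWord.rel {R : List (Fin n) → List (Fin n) → Prop} (hR : Equivalence R)
    (happ : ∀ L L' l, R L L' → R (L ++ [l]) (L' ++ [l]))
    (hcomm : ∀ L (s t : Fin n), (s : ℕ) + 1 < t → R (L ++ [s] ++ [t]) (L ++ [t] ++ [s]))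
    (hbraid : ∀ L (s t : Fin n), (t : ℕ) = s + 1 →
      R (L ++ [s] ++ [t] ++ [s]) (L ++ [t] ++ [s] ++ [t]))
    {L L' : List (Fin n)} {w : Equiv.Perm (Fin (n + 1))} (hL : IsReducedWord L w)
    (hL' : IsReducedWord L' w) : R L L' := by
  have hlen : L.length = L'.length :=
    (isReducedWord_iff.1 hL).2.trans (isReducedWord_iff.1 hL').2.symm
  induction hm : L.length generalizing L L' w with
  | zero =>
    rw [hm] at hlen
    rw [List.length_eq_zero_iff.1 hm, List.length_eq_zero_iff.1 hlen.symm]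
    exact hR.refl _
  | succ m ih =>
    -- Both s and t are descents of w. The words are connected through a third pair of reduced words
    -- having a common prefix M, to which the induction hypothesis applies after the last letter is
    -- removed.
    have main : ∀ {L1 L1' : List (Fin n)} {s t : Fin n}, (s : ℕ) < t → L1.length = m →
        L1'.length = m → IsReducedWord (L1 ++ [s]) w → IsReducedWord (L1' ++ [t]) w →
        R (L1 ++ [s]) (L1' ++ [t]) := by
      intro L1 L1' s t hst hl hl' h h'
      obtain ⟨hs, hws⟩ := h.of_append
      obtain ⟨ht, hwt⟩ := h'.of_append
      rcases Nat.lt_or_ge ((s : ℕ) + 1) t with hst' | hst'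
      -- Distant letters: M t s and M s t are both reduced words of w.
      · obtain ⟨M, hM⟩ := exists_isReducedWord (w * simpleSwap s * simpleSwap t)
        have a1 : IsReducedWord (M ++ [t]) (w * simpleSwap s) := by
          refine .append_of_gt ?_ hM
          rw [Equiv.Perm.mul_apply, Equiv.Perm.mul_apply, simpleSwap_of_ne, simpleSwap_of_ne]
          · exact hwt
          all_goals simp only [ne_eq, Fin.ext_iff, Fin.val_castSucc, Fin.val_succ]; omega
        have a2 : IsReducedWord (M ++ [s]) (w * simpleSwap t) := by
          rw [mul_assoc, simpleSwap_comm hst', ← mul_assoc] at hM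
          refine .append_of_gt ?_ hM
          rw [Equiv.Perm.mul_apply, Equiv.Perm.mul_apply, simpleSwap_of_ne, simpleSwap_of_ne]
          · exact hws
          all_goals simp only [ne_eq, Fin.ext_iff, Fin.val_castSucc, Fin.val_succ]; omega
        have l1 := (isReducedWord_iff.1 hs).2.trans (isReducedWord_iff.1 a1).2.symm
        have l2 := (isReducedWord_iff.1 a2).2.trans (isReducedWord_iff.1 ht).2.symm
        exact hR.trans (happ _ _ _ (ih hs a1 l1 hl))
          (hR.trans (hR.symm (hcomm M s t hst')) (happ _ _ _ (ih a2 ht l2 (l2.trans hl'))))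
      · have hts : (t : ℕ) = s + 1 := by omega
        have e : s.succ = t.castSucc := by ext; simp [hts]
        have b1 : simpleSwap s t.succ = t.succ := by
          refine simpleSwap_of_ne ?_ ?_ <;>
            simp only [ne_eq, Fin.ext_iff, Fin.val_castSucc, Fin.val_succ] <;> omega
        have b2 : simpleSwap t s.castSucc = s.castSucc := by
          refine simpleSwap_of_ne ?_ ?_ <;>
            simp only [ne_eq, Fin.ext_iff, Fin.val_castSucc, Fin.val_succ] <;> omega
        have b3 : simpleSwap s t.castSucc = s.castSucc := by rw [← e, simpleSwap_succ]
        have b4 : simpleSwap t s.succ = t.succ := by rw [e, simpleSwap_castSucc]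
        rw [e] at hws
        -- Adjacent letters: w reverses three consecutive positions, so the full braid can be split
        -- off, and M s t s and M t s t are both reduced words of w.
        obtain ⟨M, hM⟩ := exists_isReducedWord (w * simpleSwap s * simpleSwap t * simpleSwap s)
        have a1 : IsReducedWord (M ++ [s] ++ [t]) (w * simpleSwap s) := by
          refine .append_of_gt ?_ (.append_of_gt ?_ hM)
          · simp only [Equiv.Perm.mul_apply, b1, b3]
            exact hwt.trans hws
          · simp only [Equiv.Perm.mul_apply, b2, b1, simpleSwap_castSucc, e]
            exact hwt
        have a2 : IsReducedWord (M ++ [t] ++ [s]) (w * simpleSwap t) := by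
          rw [mul_assoc, mul_assoc, ← mul_assoc (simpleSwap s), simpleSwap_braid hts,
            ← mul_assoc, ← mul_assoc] at hM
          refine .append_of_gt ?_ (.append_of_gt ?_ hM)
          · simp only [Equiv.Perm.mul_apply, b2, b4]
            exact hwt.trans hws
          · simp only [Equiv.Perm.mul_apply, b1, b3, b2, simpleSwap_succ]
            exact hws
        have l1 := (isReducedWord_iff.1 hs).2.trans (isReducedWord_iff.1 a1).2.symm
        have l2 := (isReducedWord_iff.1 a2).2.trans (isReducedWord_iff.1 ht).2.symm
        exact hR.trans (happ _ _ _ (ih hs a1 l1 hl))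
          (hR.trans (hbraid M s t hts) (happ _ _ _ (ih a2 ht l2 (l2.trans hl'))))
    rcases L.eq_nil_or_concat with rfl | ⟨L1, s, rfl⟩
    · simp at hm
    rcases L'.eq_nil_or_concat with rfl | ⟨L1', t, rfl⟩
    · rw [hm] at hlen
      simp at hlen
    simp only [List.concat_eq_append, List.length_append, List.length_singleton] at *
    have k1 : L1.length = m := by omega
    have k2 : L1'.length = m := by omega
    rcases lt_trichotomy (s : ℕ) t with h | h | h
    · exact main h k1 k2 hL hL'
    · obtain rfl : s = t := Fin.ext h
      exact happ _ _ _ (ih hL.of_append.1 hL'.of_append.1 (k1.trans k2.symm) k1)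
    · exact hR.symm (main h k2 k1 hL' hL)

end Inversions

end QuiverHecke

end

noncomputable section

namespace QuiverHecke

/-! ### Simple swaps and Demazure operators on polynomials -/

section PolynomialLemmas

open MvPolynomial

universe uK

variable {k : Type uK} [CommRing k]

/-- A linear change of variables turns x_r - x_s into the variable x_r, which is regular over any
commutative ring; `k` may have zero divisors. This makes the quotients defining ∂_l unique. -/
theorem X_sub_X_mul_cancel {σ : Type*} {r s : σ} (hrs : r ≠ s) {f g : MvPolynomial σ k}
    (h : (X r - X s) * f = (X r - X s) * g) : f = g := by
  classical
  let φ : MvPolynomial σ k →ₐ[k] MvPolynomial σ k := aeval (Function.update X r (X r + X s))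
  let ψ : MvPolynomial σ k →ₐ[k] MvPolynomial σ k := aeval (Function.update X r (X r - X s))
  have hψφ : ∀ p, ψ (φ p) = p := by
    intro p
    have : ψ.comp φ = AlgHom.id k _ := by
      refine MvPolynomial.algHom_ext fun t => ?_
      by_cases ht : t = r
      · subst ht
        simp [φ, ψ, Function.update_of_ne hrs.symm]
      · simp [φ, ψ, Function.update_of_ne ht]
    exact DFunLike.congr_fun this p
  have hφ : φ (X r - X s) = X r := by
    simp [φ, Function.update_of_ne hrs.symm]
  have h' := congrArg φ h
  rw [map_mul, map_mul, hφ] at h'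
  have h'' := isRegular_X.left h'
  rw [← hψφ f, ← hψφ g]
  exact congrArg ψ h''

variable {n : ℕ}

theorem sPoly_mul (l : Fin n) (f g : MvPolynomial (Fin (n + 1)) k) :
    sPoly l (f * g) = sPoly l f * sPoly l g := map_mul _ _ _

theorem sPoly_add (l : Fin n) (f g : MvPolynomial (Fin (n + 1)) k) :
    sPoly l (f + g) = sPoly l f + sPoly l g := map_add _ _ _

theorem sPoly_sub (l : Fin n) (f g : MvPolynomial (Fin (n + 1)) k) :
    sPoly l (f - g) = sPoly l f - sPoly l g := map_sub _ _ _

theorem sPoly_X (l : Fin n) (r : Fin (n + 1)) :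
    sPoly l (X r : MvPolynomial (Fin (n + 1)) k) = X (simpleSwap l r) := rename_X _ _

theorem sPoly_C (l : Fin n) (c : k) :
    sPoly l (C c : MvPolynomial (Fin (n + 1)) k) = C c := rename_C _ _

theorem sPoly_pow (l : Fin n) (f : MvPolynomial (Fin (n + 1)) k) (m : ℕ) :
    sPoly l (f ^ m) = sPoly l f ^ m := map_pow _ _ _

theorem sPoly_sPoly (l : Fin n) (f : MvPolynomial (Fin (n + 1)) k) : sPoly l (sPoly l f) = f := by
  rw [sPoly, sPoly, rename_rename]
  convert rename_id_apply f
  ext i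
  simp [simpleSwap_simpleSwap]

theorem demazure_eq {l : Fin n} {f g : MvPolynomial (Fin (n + 1)) k}
    (h : (X l.succ - X l.castSucc) * g = f - sPoly l f) : demazure l f = g :=
  X_sub_X_mul_cancel Fin.castSucc_lt_succ.ne' ((mul_demazure l f).trans h.symm)

theorem demazure_add (l : Fin n) (f g : MvPolynomial (Fin (n + 1)) k) :
    demazure l (f + g) = demazure l f + demazure l g := by
  refine demazure_eq ?_
  rw [mul_add, mul_demazure, mul_demazure, sPoly_add]
  ring

/-- The twisted Leibniz rule; it has the same shape as moving τ_l past a product, and so drives the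
induction in `tau_mul_ofPoly_mul_e_of_eq`. -/
theorem demazure_mul (l : Fin n) (f g : MvPolynomial (Fin (n + 1)) k) :
    demazure l (f * g) = sPoly l f * demazure l g + demazure l f * g := by
  refine demazure_eq ?_
  rw [mul_add, mul_left_comm, mul_demazure, ← mul_assoc, mul_demazure, sPoly_mul]
  ring

theorem demazure_eq_zero {l : Fin n} {f : MvPolynomial (Fin (n + 1)) k} (h : sPoly l f = f) :
    demazure l f = 0 := demazure_eq (by rw [h, mul_zero, sub_self])

theorem demazure_C (l : Fin n) (c : k) :
    demazure l (C c : MvPolynomial (Fin (n + 1)) k) = 0 := demazure_eq_zero (sPoly_C l c)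

theorem demazure_X_castSucc (l : Fin n) :
    demazure l (X l.castSucc : MvPolynomial (Fin (n + 1)) k) = -1 := by
  refine demazure_eq ?_
  rw [sPoly_X, simpleSwap_castSucc]
  ring

theorem demazure_X_succ (l : Fin n) :
    demazure l (X l.succ : MvPolynomial (Fin (n + 1)) k) = 1 := by
  refine demazure_eq ?_
  rw [sPoly_X, simpleSwap_succ]
  ring

theorem demazure_X_of_ne {l : Fin n} {r : Fin (n + 1)} (h1 : r ≠ l.castSucc) (h2 : r ≠ l.succ) :
    demazure l (X r : MvPolynomial (Fin (n + 1)) k) = 0 :=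
  demazure_eq_zero (by rw [sPoly_X, simpleSwap_of_ne h1 h2])

theorem sPoly_demazure (l : Fin n) (f : MvPolynomial (Fin (n + 1)) k) :
    sPoly l (demazure l f) = demazure l f := by
  symm
  refine demazure_eq ?_
  have h := congrArg (sPoly l) (mul_demazure l f)
  rw [sPoly_mul, sPoly_sub, sPoly_sub, sPoly_sPoly, sPoly_X, sPoly_X, simpleSwap_succ,
    simpleSwap_castSucc] at h
  linear_combination -h

theorem sPoly_eq_sub (l : Fin n) (f : MvPolynomial (Fin (n + 1)) k) :
    sPoly l f = f - (X l.succ - X l.castSucc) * demazure l f := by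
  rw [mul_demazure]
  ring

/-! ### Which variables occur -/

section Supported

theorem sPoly_mem_supported {l : Fin n} {s t : Set (Fin (n + 1))}
    (hst : ∀ i ∈ s, simpleSwap l i ∈ t) {f : MvPolynomial (Fin (n + 1)) k}
    (hf : f ∈ supported k s) : sPoly l f ∈ supported k t := by
  induction hf using Algebra.adjoin_induction with
  | mem _ h =>
    obtain ⟨i, hi, rfl⟩ := h
    rw [sPoly_X]
    exact Algebra.subset_adjoin ⟨_, hst i hi, rfl⟩
  | algebraMap c =>
    rw [algebraMap_eq, sPoly_C, ← algebraMap_eq]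
    exact Subalgebra.algebraMap_mem _ _
  | add f g _ _ hf hg => exact sPoly_add l f g ▸ add_mem hf hg
  | mul f g _ _ hf hg => exact sPoly_mul l f g ▸ mul_mem hf hg

theorem sPoly_of_mem_supported {l : Fin n} {s : Set (Fin (n + 1))}
    (h1 : l.castSucc ∉ s) (h2 : l.succ ∉ s) {f : MvPolynomial (Fin (n + 1)) k}
    (hf : f ∈ supported k s) : sPoly l f = f := by
  induction hf using Algebra.adjoin_induction with
  | mem _ h =>
    obtain ⟨i, hi, rfl⟩ := h
    rw [sPoly_X, simpleSwap_of_ne] <;> rintro rfl <;> contradiction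
  | algebraMap c => exact sPoly_C l c
  | add f g _ _ hf hg => rw [sPoly_add, hf, hg]
  | mul f g _ _ hf hg => rw [sPoly_mul, hf, hg]

theorem demazure_mem_supported {l : Fin n} {f : MvPolynomial (Fin (n + 1)) k}
    (hf : f ∈ supported k (Set.Iic l.castSucc)) :
    demazure l f ∈ supported k (Set.Iic l.succ) := by
  have hle : supported k (Set.Iic l.castSucc) ≤ supported k (Set.Iic l.succ) :=
    supported_mono (Set.Iic_subset_Iic.2 Fin.castSucc_lt_succ.le)
  have hswap : ∀ i ∈ Set.Iic l.castSucc, simpleSwap l i ∈ Set.Iic l.succ := by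
    intro i hi
    rw [Set.mem_Iic] at *
    by_cases h : i = l.castSucc
    · rw [h, simpleSwap_castSucc]
    · rw [simpleSwap_of_ne h (hi.trans_lt Fin.castSucc_lt_succ).ne]
      exact hi.trans Fin.castSucc_lt_succ.le
  induction hf using Algebra.adjoin_induction with
  | mem _ h =>
    obtain ⟨i, hi, rfl⟩ := h
    by_cases h : i = l.castSucc
    · rw [h, demazure_X_castSucc]
      exact neg_mem (one_mem _)
    · rw [demazure_X_of_ne h (lt_of_le_of_lt hi Fin.castSucc_lt_succ).ne]
      exact zero_mem _
  | algebraMap c =>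
    rw [algebraMap_eq, demazure_C]
    exact zero_mem _
  | add f g _ _ hf hg => exact demazure_add l f g ▸ add_mem hf hg
  | mul f g hf0 hg0 hf hg =>
    rw [demazure_mul]
    exact add_mem (mul_mem (sPoly_mem_supported hswap hf0) hg) (mul_mem hf (hle hg0))

end Supported

/-! ### Degree in one variable and unit leading coefficients -/

section DegreeBounds

variable {σ : Type*}

/-- The degree of `f` in the variable `x_r` is less than `N`. -/
def DegLt (r : σ) (N : ℕ) (f : MvPolynomial σ k) : Prop := ∀ m ∈ f.support, m r < N

theorem DegLt.mono {r : σ} {M N : ℕ} {f : MvPolynomial σ k} (hf : DegLt r M f) (h : M ≤ N) :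
    DegLt r N f := fun m hm => (hf m hm).trans_le h

theorem DegLt.add {r : σ} {N : ℕ} {f g : MvPolynomial σ k} (hf : DegLt r N f)
    (hg : DegLt r N g) : DegLt r N (f + g) := by
  classical
  intro m hm
  rcases Finset.mem_union.1 (support_add hm) with h | h
  exacts [hf m h, hg m h]

theorem DegLt.zero (r : σ) (N : ℕ) : DegLt r N (0 : MvPolynomial σ k) := by
  simp [DegLt]

theorem DegLt.neg {r : σ} {N : ℕ} {f : MvPolynomial σ k} (hf : DegLt r N f) :
    DegLt r N (-f) := by
  intro m hm
  rw [support_neg] at hm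
  exact hf m hm

/-- The truncated subtraction is harmless: a bound of 0 means that the polynomial vanishes. -/
theorem DegLt.mul {r : σ} {M N : ℕ} {f g : MvPolynomial σ k} (hf : DegLt r M f)
    (hg : DegLt r N g) : DegLt r (M + N - 1) (f * g) := by
  classical
  intro m hm
  obtain ⟨a, ha, b, hb, rfl⟩ := Finset.mem_add.1 (support_mul f g hm)
  have h1 := hf a ha
  have h2 := hg b hb
  rw [Finsupp.add_apply]
  omega

theorem DegLt.eq_zero {r : σ} {f : MvPolynomial σ k} (hf : DegLt r 0 f) : f = 0 := by
  rw [← support_eq_empty, Finset.eq_empty_iff_forall_notMem]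
  intro m hm
  exact absurd (hf m hm) (Nat.not_lt_zero _)

theorem DegLt.monomial {r : σ} {N : ℕ} {m : σ →₀ ℕ} (c : k) (h : m r < N) :
    DegLt r N (monomial m c) := by
  classical
  intro m' hm'
  rw [Finset.mem_singleton.1 (support_monomial_subset hm')]
  exact h

theorem DegLt.C (r : σ) (c : k) : DegLt r 1 (C c : MvPolynomial σ k) :=
  .monomial c (by simp)

theorem DegLt.X_pow (r : σ) (N : ℕ) : DegLt r (N + 1) (X r ^ N : MvPolynomial σ k) := by
  rw [X_pow_eq_monomial]
  exact .monomial 1 (by simp)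

theorem DegLt.X_of_ne {r s : σ} (h : s ≠ r) : DegLt r 1 (X s : MvPolynomial σ k) :=
  .monomial 1 (by simp [Finsupp.single_eq_of_ne h.symm])

theorem DegLt.sum {r : σ} {N : ℕ} {ι : Type*} {t : Finset ι} {f : ι → MvPolynomial σ k}
    (h : ∀ i ∈ t, DegLt r N (f i)) : DegLt r N (∑ i ∈ t, f i) := by
  classical
  induction t using Finset.induction_on with
  | empty => simpa using DegLt.zero r N
  | insert i t hi ih =>
    rw [Finset.sum_insert hi]
    exact (h i (by simp)).add (ih fun j hj => h j (by simp [hj]))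

variable {𝒜 : ℕ → AddSubgroup k}

theorem HasUnitLeadingCoeff.rename {τ : Type*} {r : σ} {f : MvPolynomial σ k}
    (hf : HasUnitLeadingCoeff 𝒜 r f) {e : σ → τ} (he : Function.Injective e) :
    HasUnitLeadingCoeff 𝒜 (e r) (rename e f) := by
  classical
  obtain ⟨N, u, h, hu, hu', hh, rfl⟩ := hf
  refine ⟨N, u, MvPolynomial.rename e h, hu, hu', fun m hm => ?_, by simp⟩
  rw [support_rename_of_injective he, Finset.mem_image] at hm
  obtain ⟨m', hm', rfl⟩ := hm
  rw [Finsupp.mapDomain_apply he]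
  exact hh m' hm'

theorem HasUnitLeadingCoeff.mul [GradedRing 𝒜] {r : σ} {f g : MvPolynomial σ k}
    (hf : HasUnitLeadingCoeff 𝒜 r f) (hg : HasUnitLeadingCoeff 𝒜 r g) :
    HasUnitLeadingCoeff 𝒜 r (f * g) := by
  obtain ⟨N, u, h, hu, hu', hh, rfl⟩ := hf
  obtain ⟨N', v, h', hv, hv', hh', rfl⟩ := hg
  refine ⟨N + N', u * v, C u * (X r ^ N * h') + C v * (X r ^ N' * h) + h * h', ?_,
    hu'.mul hv', ?_, ?_⟩
  · simpa using SetLike.mul_mem_graded hu hv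
  · refine DegLt.add (.add (DegLt.mono ((DegLt.C r u).mul ((DegLt.X_pow r N).mul hh')) ?_)
      (DegLt.mono ((DegLt.C r v).mul ((DegLt.X_pow r N').mul hh)) ?_))
      (DegLt.mono (DegLt.mul hh hh') ?_) <;> omega
  · rw [C_mul, pow_add]
    ring

theorem aeval_X_hasUnitLeadingCoeff [GradedRing 𝒜] {N : ℕ} {q : Polynomial k}
    (hq : q.IsMonicOfDegree N) (r : σ) :
    HasUnitLeadingCoeff 𝒜 r (Polynomial.aeval (X r : MvPolynomial σ k) q) := by
  obtain ⟨hN, hm⟩ := hq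
  refine ⟨N, 1, Polynomial.aeval (X r) q.eraseLead, SetLike.GradedOne.one_mem, isUnit_one,
    ?_, ?_⟩
  · rw [Polynomial.aeval_eq_sum_range]
    refine DegLt.sum fun i _ => ?_
    by_cases hi : i < N
    · rw [smul_eq_C_mul]
      exact ((DegLt.C r _).mul (.X_pow r i)).mono (by omega)
    · have : q.eraseLead.coeff i = 0 := by
        rcases eq_or_ne i N with rfl | hne
        · rw [← hN, Polynomial.eraseLead_coeff_natDegree]
        · rw [Polynomial.eraseLead_coeff_of_ne _ (by rw [hN]; exact hne)]
          exact Polynomial.coeff_eq_zero_of_natDegree_lt (by omega)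
      rw [this, zero_smul]
      exact .zero r N
  · conv_lhs => rw [← Polynomial.eraseLead_add_C_mul_X_pow q]
    rw [hm, hN, map_add, map_mul, map_pow, Polynomial.aeval_X, Polynomial.aeval_C]
    simp [add_comm]

/-- The quotient is minus the sum of all monomials of degree a in x_l and x_{l+1}; only its top term
in x_{l+1} matters. -/
theorem demazure_X_pow (l : Fin n) (a : ℕ) :
    ∃ h : MvPolynomial (Fin (n + 1)) k, DegLt l.succ a h ∧
      demazure l (X l.castSucc ^ (a + 1)) = -X l.succ ^ a + h := by
  induction a with
  | zero => exact ⟨0, .zero _ _, by rw [zero_add, pow_one, demazure_X_castSucc]; simp⟩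
  | succ a ih =>
    obtain ⟨h, hh, e⟩ := ih
    refine ⟨(-X l.succ ^ a + h) * X l.castSucc, ?_, ?_⟩
    · refine ((DegLt.X_pow _ a).neg.add (hh.mono (Nat.le_succ a))).mul
        (.X_of_ne Fin.castSucc_lt_succ.ne)
    · rw [pow_succ, demazure_mul, e, demazure_X_castSucc, sPoly_pow, sPoly_X,
        simpleSwap_castSucc]
      ring

theorem DegLt.demazure_X_pow {l : Fin n} {a N : ℕ} (h : a < N + 1) :
    DegLt l.succ N (demazure l (X l.castSucc ^ a : MvPolynomial (Fin (n + 1)) k)) := by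
  rcases a with _ | a
  · rw [pow_zero, ← C_1, demazure_C]
    exact .zero _ _
  · obtain ⟨g, hg, e⟩ := QuiverHecke.demazure_X_pow (k := k) l a
    rw [e]
    exact ((DegLt.X_pow _ a).neg.mono (by omega)).add (hg.mono (by omega))

theorem demazure_sum (l : Fin n) {ι : Type*} (t : Finset ι)
    (f : ι → MvPolynomial (Fin (n + 1)) k) :
    demazure l (∑ i ∈ t, f i) = ∑ i ∈ t, demazure l (f i) := by
  refine demazure_eq ?_
  rw [Finset.mul_sum, sPoly, map_sum, ← Finset.sum_sub_distrib]
  exact Finset.sum_congr rfl fun i _ => mul_demazure l (f i)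

/-- In each monomial the part outside x_l is fixed by s_l, because x_{l+1} does not occur; it
therefore passes through ∂_l as a scalar and leaves a pure power of x_l. -/
theorem DegLt.demazure {l : Fin n} {N : ℕ} {h : MvPolynomial (Fin (n + 1)) k}
    (hh : DegLt l.castSucc (N + 1) h) (h0 : DegLt l.succ 1 h) :
    DegLt l.succ N (demazure l h) := by
  rw [h.as_sum, demazure_sum]
  refine DegLt.sum fun m hm => ?_
  have hm1 := hh m hm
  have hm0 := h0 m hm
  have e : MvPolynomial.monomial m (h.coeff m) =
      MvPolynomial.monomial (m.erase l.castSucc) (h.coeff m) * X l.castSucc ^ m l.castSucc := by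
    rw [X_pow_eq_monomial, monomial_mul, mul_one, Finsupp.erase_add_single]
  have hs : sPoly l (MvPolynomial.monomial (m.erase l.castSucc) (h.coeff m)) =
      MvPolynomial.monomial (m.erase l.castSucc) (h.coeff m) := by
    rw [sPoly, rename_monomial]
    refine congrArg (fun t => MvPolynomial.monomial t (h.coeff m)) (Finsupp.ext fun i => ?_)
    rw [← simpleSwap_simpleSwap l i, Finsupp.mapDomain_apply (simpleSwap l).injective,
      simpleSwap_simpleSwap]
    by_cases h1 : i = l.castSucc
    · rw [h1, simpleSwap_castSucc, Finsupp.erase_same,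
        Finsupp.erase_ne Fin.castSucc_lt_succ.ne']
      omega
    by_cases h2 : i = l.succ
    · rw [h2, simpleSwap_succ, Finsupp.erase_same, Finsupp.erase_ne Fin.castSucc_lt_succ.ne']
      omega
    rw [simpleSwap_of_ne h1 h2]
  rw [e, demazure_mul, demazure_eq_zero hs, hs, zero_mul, add_zero]
  refine DegLt.mono (.mul (.monomial (N := 1) _ ?_) (.demazure_X_pow hm1)) (by omega)
  rw [Finsupp.erase_ne Fin.castSucc_lt_succ.ne']
  exact hm0

theorem degLt_one_of_mem_supported {s : Set σ} {r : σ} (hr : r ∉ s) {f : MvPolynomial σ k}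
    (hf : f ∈ supported k s) : DegLt r 1 f := by
  intro m hm
  rw [mem_supported] at hf
  by_contra hmr
  refine hr (hf ?_)
  rw [Finset.mem_coe, mem_vars_iff_mem_support]
  exact ⟨m, hm, by rw [Finsupp.mem_support_iff]; omega⟩

theorem HasUnitLeadingCoeff.demazure {l : Fin n} {f : MvPolynomial (Fin (n + 1)) k}
    (hf : HasUnitLeadingCoeff 𝒜 l.castSucc f) (hs : f ∈ supported k (Set.Iic l.castSucc)) :
    HasUnitLeadingCoeff 𝒜 l.succ (demazure l f) ∨
      (QuiverHecke.demazure l f = 0 ∧ ∃ u ∈ 𝒜 0, IsUnit u ∧ f = C u) := by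
  obtain ⟨N, u, h, hu, hu', hh, rfl⟩ := hf
  rcases N with _ | N
  · right
    have h0 : h = 0 := DegLt.eq_zero hh
    subst h0
    rw [pow_zero, mul_one, add_zero, demazure_C]
    exact ⟨rfl, u, hu, hu', rfl⟩
  · left
    obtain ⟨g, hg, e⟩ := demazure_X_pow (k := k) l N
    have hX : DegLt l.succ 1 (X l.castSucc ^ (N + 1) : MvPolynomial (Fin (n + 1)) k) := by
      rw [X_pow_eq_monomial]
      exact .monomial _ (by simp [Finsupp.single_eq_of_ne Fin.castSucc_lt_succ.ne'])
    -- The remainder h is f minus its leading term, and neither of these involves x_{l+1}.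
    have h0 : DegLt l.succ 1 h := by
      have h1 := (degLt_one_of_mem_supported (r := l.succ)
        (by simp) hs).add ((DegLt.C l.succ u).mul hX).neg
      rwa [add_right_comm, add_neg_cancel, zero_add] at h1
    refine ⟨N, -u, C u * g + QuiverHecke.demazure l h, neg_mem hu, hu'.neg, ?_, ?_⟩
    · exact DegLt.add (DegLt.mono ((DegLt.C _ u).mul hg) (by omega)) (DegLt.demazure hh h0)
    · rw [demazure_add, demazure_mul, e, demazure_C, sPoly_C, C_neg]
      ring

end DegreeBounds

/-! ### The leading term of Q -/

section QMatrix

universe uI uP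

variable {I : Type uI} {P : Type uP} [DecidableEq I] [AddCommGroup P]
  {𝒜 : ℕ → AddSubgroup k} {D : CartanDatum I P} {Q : I → I → MvPolynomial (Fin 2) k}

theorem HomogOfDeg.eq_zero {z : ℤ} {c : k} (h : HomogOfDeg 𝒜 z c) (hz : z < 0) : c = 0 := by
  rcases h with h | ⟨m, hm, -⟩
  · exact h
  · omega

theorem coeff_eq_coeffQ {J : Type*} (Q : J → J → MvPolynomial (Fin 2) k) (i j : J)
    (m : Fin 2 →₀ ℕ) :
    (Q i j).coeff m = coeffQ Q i j (m 0) (m 1) := by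
  rw [coeffQ]
  congr 1
  ext t
  fin_cases t <;> simp

theorem IsQMatrix.coeffQ_swap (hQ : IsQMatrix D 𝒜 Q) (i j : I) (p q : ℕ) :
    coeffQ Q i j p q = coeffQ Q j i q p := by
  have h : Finsupp.mapDomain (Equiv.swap (0 : Fin 2) 1)
      (Finsupp.single 0 q + Finsupp.single 1 p) =
      (Finsupp.single 0 p + Finsupp.single 1 q : Fin 2 →₀ ℕ) := by
    rw [Finsupp.mapDomain_add, Finsupp.mapDomain_single, Finsupp.mapDomain_single, add_comm]
    simp
  rw [coeffQ, hQ.symm, ← h, coeff_rename_mapDomain _ (Equiv.injective _), coeffQ]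

/-- Put M = -a_{ji}. The coefficient of u^p v^q has degree 2 d_j M - 2 d_i p - 2 d_j q, which is
negative if q > M, or if q = M and p > 0. So v^M is the only term of v-degree at least M, and by
symmetry its coefficient is the unit c_{j,i,M,0}. -/
theorem IsQMatrix.hasUnitLeadingCoeff (hQ : IsQMatrix D 𝒜 Q) {i j : I} (hij : i ≠ j) :
    HasUnitLeadingCoeff 𝒜 1 (Q i j) := by
  obtain ⟨hu, hu'⟩ := hQ.unit j i hij.symm
  have hM : ((-D.A j i).toNat : ℤ) = -D.A j i :=
    Int.toNat_of_nonneg (by linarith [D.A_offDiag j i hij.symm])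
  refine ⟨(-D.A j i).toNat, _, Q i j - C (coeffQ Q j i (-D.A j i).toNat 0) *
    X 1 ^ (-D.A j i).toNat, hu, hu', fun m hm => ?_, by ring⟩
  by_contra hlt
  refine (mem_support_iff.1 hm) ?_
  rw [coeff_sub, coeff_eq_coeffQ, X_pow_eq_monomial, coeff_C_mul, coeff_monomial]
  generalize (-D.A j i).toNat = M at *
  by_cases hcase : m 0 = 0 ∧ m 1 = M
  · rw [if_pos, hcase.1, hcase.2, hQ.coeffQ_swap, mul_one, sub_self]
    ext t
    fin_cases t <;> simp [hcase.1, hcase.2]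
  · rw [if_neg, mul_zero, sub_zero]
    · refine (hQ.homog i j hij _ _).eq_zero ?_
      have hi := D.d_pos i
      have hj := D.d_pos j
      simp only [CartanDatum.form, D.A_diag, D.symmetrizable i j]
      have hA : D.A j i = -M := by rw [hM]; ring
      rw [hA]
      rcases Nat.lt_or_ge M (m 1) with h | h
      · have h' : (M : ℤ) + 1 ≤ m 1 := by exact_mod_cast h
        nlinarith [mul_nonneg hi.le (Int.natCast_nonneg (m 0))]
      · have h1 : m 1 = M := by omega
        have h2 : (1 : ℤ) ≤ m 0 := by
          have : m 0 ≠ 0 := fun h0 => hcase ⟨h0, h1⟩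
          omega
        rw [h1]
        nlinarith
    · rintro rfl
      exact hcase (by simp)

theorem evalQ_eq_rename {J σ : Type*} (Q : J → J → MvPolynomial (Fin 2) k) (i j : J) (r s : σ) :
    evalQ Q i j r s = rename ![r, s] (Q i j) := by
  rw [evalQ]
  refine DFunLike.congr_fun (MvPolynomial.algHom_ext fun t => ?_) (Q i j)
  rw [aeval_X, rename_X]
  fin_cases t <;> rfl

theorem IsQMatrix.evalQ_hasUnitLeadingCoeff (hQ : IsQMatrix D 𝒜 Q) {i j : I} (hij : i ≠ j)
    {σ : Type*} {r s : σ} (hrs : r ≠ s) : HasUnitLeadingCoeff 𝒜 s (evalQ Q i j r s) := by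
  rw [evalQ_eq_rename]
  refine (hQ.hasUnitLeadingCoeff hij).rename (e := ![r, s]) ?_
  intro x y hxy
  fin_cases x <;> fin_cases y <;> simp_all

theorem evalQ_mem_supported {J σ : Type*} {Q : J → J → MvPolynomial (Fin 2) k} {i j : J}
    {r s : σ} {t : Set σ} (hr : r ∈ t) (hs : s ∈ t) : evalQ Q i j r s ∈ supported k t := by
  rw [evalQ]
  induction Q i j using MvPolynomial.induction_on with
  | C c => 
    rw [← algebraMap_eq, AlgHom.commutes]
    exact Subalgebra.algebraMap_mem (supported k t) c
  | add f g hf hg =>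
    rw [map_add]
    exact add_mem hf hg
  | mul_X f i hf =>
    rw [map_mul, aeval_X]
    refine mul_mem hf ?_
    fin_cases i
    · exact Algebra.subset_adjoin ⟨r, hr, rfl⟩
    · exact Algebra.subset_adjoin ⟨s, hs, rfl⟩

end QMatrix

/-! ### Support and leading coefficient of g -/

section GPoly

universe uI uP

variable {I : Type uI} [DecidableEq I] {Q : I → I → MvPolynomial (Fin 2) k}
  {a : I → Polynomial k} {p : ℕ} {c : Fin p → I}

theorem gPoly_zero (ν : Fin (n + 1) → I) :
    gPoly Q a c 0 ν = Polynomial.aeval (X 0) (a (ν 0)) := rfl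

theorem gPoly_succ_of_eq {l : Fin n} {ν : Fin (n + 1) → I} (h : ν l.castSucc = ν l.succ) :
    gPoly Q a c l.succ ν = demazure l (gPoly Q a c l.castSucc ν) := by
  rw [gPoly, Fin.induction_succ, if_pos h]
  rfl

theorem gPoly_succ_of_prec {l : Fin n} {ν : Fin (n + 1) → I} (h : ν l.castSucc ≠ ν l.succ)
    (h' : Prec c (ν l.succ) (ν l.castSucc)) :
    gPoly Q a c l.succ ν =
      sPoly l (gPoly Q a c l.castSucc (permSeq (simpleSwap l) ν)) := by
  rw [gPoly, Fin.induction_succ, if_neg h, if_pos h']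
  rfl

theorem gPoly_succ_of_not_prec {l : Fin n} {ν : Fin (n + 1) → I} (h : ν l.castSucc ≠ ν l.succ)
    (h' : ¬Prec c (ν l.succ) (ν l.castSucc)) :
    gPoly Q a c l.succ ν =
      sPoly l (gPoly Q a c l.castSucc (permSeq (simpleSwap l) ν)) *
        evalQ Q (ν l.castSucc) (ν l.succ) l.castSucc l.succ := by
  rw [gPoly, Fin.induction_succ, if_neg h, if_neg h']
  rfl

theorem permSeq_simpleSwap_apply {J : Type*} (l : Fin n) (ν : Fin (n + 1) → J) (i : Fin (n + 1)) :
    permSeq (simpleSwap l) ν i = ν (simpleSwap l i) := by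
  rw [permSeq, simpleSwap_inv]

theorem simpleSwap_le_of_le {l : Fin n} {i : Fin (n + 1)} (h : i ≤ l.castSucc) :
    simpleSwap l i ≤ l.succ := by
  by_cases h1 : i = l.castSucc
  · rw [h1, simpleSwap_castSucc]
  · rw [simpleSwap_of_ne h1 (h.trans_lt Fin.castSucc_lt_succ).ne]
    exact h.trans Fin.castSucc_lt_succ.le

/-- The recursion up to level r only permutes the first r positions. Hence g_{ν,r} does not see a
swap of later positions. -/
theorem gPoly_congr {r : Fin (n + 1)} {ν μ : Fin (n + 1) → I} (h : ∀ s ≤ r, ν s = μ s) :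
    gPoly Q a c r ν = gPoly Q a c r μ := by
  induction r using Fin.induction generalizing ν μ with
  | zero => rw [gPoly_zero, gPoly_zero, h 0 le_rfl]
  | succ l ih =>
    have h1 := h l.castSucc Fin.castSucc_lt_succ.le
    have h2 := h l.succ le_rfl
    have hs : gPoly Q a c l.castSucc (permSeq (simpleSwap l) ν) =
        gPoly Q a c l.castSucc (permSeq (simpleSwap l) μ) := ih fun s hs => by
      rw [permSeq_simpleSwap_apply, permSeq_simpleSwap_apply, h _ (simpleSwap_le_of_le hs)]
    by_cases e : ν l.castSucc = ν l.succ
    · rw [gPoly_succ_of_eq e, gPoly_succ_of_eq (by rw [← h1, ← h2, e]),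
        ih fun s hs => h s (hs.trans Fin.castSucc_lt_succ.le)]
    have e' : μ l.castSucc ≠ μ l.succ := by rwa [← h1, ← h2]
    by_cases hp : Prec c (ν l.succ) (ν l.castSucc)
    · rw [gPoly_succ_of_prec e hp, gPoly_succ_of_prec e' (by rwa [← h1, ← h2]), hs]
    · rw [gPoly_succ_of_not_prec e hp, gPoly_succ_of_not_prec e' (by rwa [← h1, ← h2]), hs,
        h1, h2]

theorem gPoly_mem_supported (r : Fin (n + 1)) (ν : Fin (n + 1) → I) :
    gPoly Q a c r ν ∈ supported k (Set.Iic r) := by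
  induction r using Fin.induction generalizing ν with
  | zero =>
    rw [gPoly_zero, Polynomial.aeval_eq_sum_range]
    exact sum_mem fun i _ => Subalgebra.smul_mem _
      (pow_mem (Algebra.subset_adjoin (Set.mem_image_of_mem _ (Set.mem_Iic.2 le_rfl))) _) _
  | succ l ih =>
    have hs := sPoly_mem_supported (t := Set.Iic l.succ) (fun i hi => simpleSwap_le_of_le hi)
      (ih (permSeq (simpleSwap l) ν))
    by_cases e : ν l.castSucc = ν l.succ
    · rw [gPoly_succ_of_eq e]
      exact demazure_mem_supported (ih ν)
    by_cases hp : Prec c (ν l.succ) (ν l.castSucc)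
    · rw [gPoly_succ_of_prec e hp]
      exact hs
    · rw [gPoly_succ_of_not_prec e hp]
      exact mul_mem hs (evalQ_mem_supported Fin.castSucc_lt_succ.le (Set.mem_Iic.2 le_rfl))

variable {P : Type uP} [AddCommGroup P] {𝒜 : ℕ → AddSubgroup k} [GradedRing 𝒜]
  {D : CartanDatum I P} {Λ : P}

theorem gPoly_leadingCoeff (hQ : IsQMatrix D 𝒜 Q) (ha : IsCyclotomicFamily D 𝒜 Λ a)
    (r : Fin (n + 1)) (ν : Fin (n + 1) → I) :
    HasUnitLeadingCoeff 𝒜 r (gPoly Q a c r ν) ∨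
      (gPoly Q a c r ν = 0 ∧
        ∃ s < r, ∃ u : k, u ∈ 𝒜 0 ∧ IsUnit u ∧ gPoly Q a c s ν = C u) := by
  induction r using Fin.induction generalizing ν with
  | zero => exact Or.inl (aeval_X_hasUnitLeadingCoeff (ha.monic _) _)
  | succ l ih =>
    have hlt : l.castSucc < l.succ := Fin.castSucc_lt_succ
    by_cases e : ν l.castSucc = ν l.succ
    · rw [gPoly_succ_of_eq e]
      rcases ih ν with h | ⟨h0, s, hs, hu⟩
      · refine (h.demazure (gPoly_mem_supported _ _)).imp_right ?_
        rintro ⟨h0, u, hu, hu', hC⟩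
        exact ⟨h0, l.castSucc, hlt, u, hu, hu', hC⟩
      · refine Or.inr ⟨?_, s, hs.trans hlt, hu⟩
        rw [h0]
        exact demazure_eq_zero (map_zero _)
    · have hs : HasUnitLeadingCoeff 𝒜 l.succ
          (sPoly l (gPoly Q a c l.castSucc (permSeq (simpleSwap l) ν))) ∨
          (sPoly l (gPoly Q a c l.castSucc (permSeq (simpleSwap l) ν)) = 0 ∧
            ∃ s < l.succ, ∃ u : k, u ∈ 𝒜 0 ∧ IsUnit u ∧ gPoly Q a c s ν = C u) := by
        rcases ih (permSeq (simpleSwap l) ν) with h | ⟨h0, s, hs, hu⟩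
        · left
          have h' := h.rename (simpleSwap l).injective
          rwa [simpleSwap_castSucc] at h'
        · refine Or.inr ⟨by rw [h0]; exact map_zero _, s, hs.trans hlt, ?_⟩
          -- The constant was found for s_l.ν; its index s lies strictly below l, where s_l.ν and ν
          -- agree.
          rwa [gPoly_congr (μ := ν)] at hu
          intro t ht
          rw [permSeq_simpleSwap_apply, simpleSwap_of_ne (ht.trans_lt hs).ne
            ((ht.trans_lt hs).trans hlt).ne]
      by_cases hp : Prec c (ν l.succ) (ν l.castSucc)
      · rw [gPoly_succ_of_prec e hp]
        exact hs
      · rw [gPoly_succ_of_not_prec e hp]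
        rcases hs with h | ⟨h0, hu⟩
        · exact Or.inl (h.mul (hQ.evalQ_hasUnitLeadingCoeff e hlt.ne))
        · exact Or.inr ⟨by rw [h0, zero_mul], hu⟩

end GPoly

end PolynomialLemmas

end QuiverHecke

end

noncomputable section

namespace QuiverHecke

open MvPolynomial

universe uI uP uK

variable {I : Type uI} {P : Type uP} [DecidableEq I] [AddCommGroup P]

/-! ### The action on colour sequences -/

section SequenceAction

variable {D : CartanDatum I P} {N : ℕ} {β : P}

theorem CartanDatum.Seq.act_mul (w w' : Equiv.Perm (Fin N)) (ν : D.Seq N β) :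
    ν.act (w * w') = (ν.act w').act w := by
  refine Subtype.ext (funext fun r => ?_)
  simp [CartanDatum.Seq.act, permSeq]

theorem CartanDatum.Seq.act_one (ν : D.Seq N β) : ν.act 1 = ν := rfl

theorem CartanDatum.Seq.act_apply (w : Equiv.Perm (Fin N)) (ν : D.Seq N β) (r : Fin N) :
    ν.act w (w r) = ν r := by
  simp [CartanDatum.Seq.act, permSeq]

variable {n : ℕ}

theorem CartanDatum.Seq.act_simpleSwap_act (l : Fin n) (ν : D.Seq (n + 1) β) :
    (ν.act (simpleSwap l)).act (simpleSwap l) = ν := by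
  rw [← act_mul, simpleSwap_mul_self, act_one]

theorem CartanDatum.Seq.act_simpleSwap_apply (l : Fin n) (ν : D.Seq (n + 1) β)
    (r : Fin (n + 1)) : ν.act (simpleSwap l) r = ν (simpleSwap l r) :=
  permSeq_simpleSwap_apply l ν.1 r

theorem CartanDatum.Seq.act_simpleSwap_of_eq {l : Fin n} {ν : D.Seq (n + 1) β}
    (h : ν l.castSucc = ν l.succ) : ν.act (simpleSwap l) = ν := by
  refine Subtype.ext (funext fun r => ?_)
  rw [act_simpleSwap_apply]
  by_cases h1 : r = l.castSucc
  · rw [h1, simpleSwap_castSucc, h]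
  by_cases h2 : r = l.succ
  · rw [h2, simpleSwap_succ, h]
  rw [simpleSwap_of_ne h1 h2]

end SequenceAction

namespace KLRAlgebra

variable {k : Type uK} [CommRing k] [Finite I] {D : CartanDatum I P}
  {Q : I → I → MvPolynomial (Fin 2) k} {n : ℕ} {β : P}

/-! ### KLR relations applied to idempotents -/

section Relations

theorem mk_eq_mk {y z : FreeKLR k D n β} (h : Rel D Q n β y z) : mk D Q β y = mk D Q β z :=
  RingQuot.mkAlgHom_rel k h

theorem e_mul_self (ν : D.Seq (n + 1) β) : e D Q ν * e D Q ν = e D Q ν := by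
  have h := mk_eq_mk (Rel.e_mul_self (Q := Q) ν)
  rwa [map_mul] at h

theorem e_mul_e {ν μ : D.Seq (n + 1) β} (h : ν ≠ μ) : e D Q ν * e D Q μ = 0 := by
  have h := mk_eq_mk (Rel.e_mul_e (Q := Q) ν μ h)
  rwa [map_mul, map_zero] at h

theorem sum_e : ∑ ν : D.Seq (n + 1) β, e D Q ν = 1 := by
  have h := mk_eq_mk (Rel.sum_e (D := D) (Q := Q) (n := n) (β := β))
  rwa [map_sum, map_one] at h

theorem x_mul_e (r : Fin (n + 1)) (ν : D.Seq (n + 1) β) :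
    x D Q β r * e D Q ν = e D Q ν * x D Q β r := by
  have h := mk_eq_mk (Rel.x_mul_e (Q := Q) r ν)
  rwa [map_mul, map_mul] at h

theorem tau_mul_e (l : Fin n) (ν : D.Seq (n + 1) β) :
    tau D Q β l * e D Q ν = e D Q (ν.act (simpleSwap l)) * tau D Q β l := by
  have h := mk_eq_mk (Rel.tau_mul_e (Q := Q) l ν)
  rwa [map_mul, map_mul] at h

theorem e_mul_tau (l : Fin n) (ν : D.Seq (n + 1) β) :
    e D Q ν * tau D Q β l = tau D Q β l * e D Q (ν.act (simpleSwap l)) := by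
  rw [tau_mul_e, ν.act_simpleSwap_act]

theorem tau_mul_tau {l m : Fin n} (h : (l : ℕ) + 1 < m) :
    tau D Q β l * tau D Q β m = tau D Q β m * tau D Q β l := by
  have h := mk_eq_mk (Rel.tau_mul_tau (D := D) (Q := Q) (β := β) l m h)
  rwa [map_mul, map_mul] at h

theorem tau_mul_tau_mul_e (l : Fin n) (ν : D.Seq (n + 1) β) :
    tau D Q β l * tau D Q β l * e D Q ν =
      ofPoly D Q β (evalQ Q (ν l.castSucc) (ν l.succ) l.castSucc l.succ) * e D Q ν := by
  have h := mk_eq_mk (Rel.tau_sq (Q := Q) l ν)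
  rwa [map_mul, map_mul, mk_poly, pow_two, map_mul] at h

theorem tau_mul_x_mul_e (l : Fin n) (r : Fin (n + 1)) (ν : D.Seq (n + 1) β) :
    tau D Q β l * x D Q β r * e D Q ν = x D Q β (simpleSwap l r) * tau D Q β l * e D Q ν +
      (if r = l.castSucc ∧ ν l.castSucc = ν l.succ then -e D Q ν
        else if r = l.succ ∧ ν l.castSucc = ν l.succ then e D Q ν else 0) := by
  have h := mk_eq_mk (Rel.tau_x (Q := Q) l r ν)
  rw [map_mul, map_sub, map_mul, map_mul, sub_mul, apply_ite (mk D Q β),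
    apply_ite (mk D Q β), map_zero, map_neg] at h
  exact sub_eq_iff_eq_add'.1 h

theorem braid_mul_e {l m : Fin n} (hlm : (m : ℕ) = l + 1) (ν : D.Seq (n + 1) β) :
    (tau D Q β m * tau D Q β l * tau D Q β m - tau D Q β l * tau D Q β m * tau D Q β l) *
      e D Q ν =
      if ν l.castSucc = ν m.succ then
        ofPoly D Q β (braidPoly Q (ν l.castSucc) (ν l.succ) l.castSucc l.succ m.succ) * e D Q ν
      else 0 := by
  have h := mk_eq_mk (Rel.braid (Q := Q) l m hlm ν)
  rw [map_mul, map_sub, map_mul, map_mul, map_mul, map_mul, apply_ite (mk D Q β),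
    map_zero, map_mul, mk_poly] at h
  exact h

theorem ofPoly_mul_e (f : MvPolynomial (Fin (n + 1)) k) (ν : D.Seq (n + 1) β) :
    ofPoly D Q β f * e D Q ν = e D Q ν * ofPoly D Q β f := by
  induction f using MvPolynomial.induction_on with
  | C c =>
    rw [← algebraMap_eq, AlgHom.commutes]
    exact Algebra.commutes c _
  | add f g hf hg => rw [map_add, add_mul, mul_add, hf, hg]
  | mul_X f r hf => rw [map_mul, ofPoly_X, mul_assoc, x_mul_e, ← mul_assoc, hf, mul_assoc]

theorem tau_mul_tau_mul_ofPoly_mul_e (l : Fin n) (ν : D.Seq (n + 1) β)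
    (f : MvPolynomial (Fin (n + 1)) k) :
    tau D Q β l * (tau D Q β l * ofPoly D Q β f * e D Q ν) =
      ofPoly D Q β (f * evalQ Q (ν l.castSucc) (ν l.succ) l.castSucc l.succ) * e D Q ν := by
  rw [mul_assoc, ofPoly_mul_e, ← mul_assoc, ← mul_assoc, tau_mul_tau_mul_e, mul_assoc,
    ← ofPoly_mul_e, ← mul_assoc, ← map_mul, mul_comm]

theorem tau_mul_ofPoly_mul_e_of_eq {l : Fin n} {ν : D.Seq (n + 1) β}
    (h : ν l.castSucc = ν l.succ) (f : MvPolynomial (Fin (n + 1)) k) :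
    tau D Q β l * ofPoly D Q β f * e D Q ν =
      ofPoly D Q β (sPoly l f) * tau D Q β l * e D Q ν +
        ofPoly D Q β (demazure l f) * e D Q ν := by
  induction f using MvPolynomial.induction_on with
  | C c =>
    rw [sPoly_C, demazure_C, map_zero, zero_mul, add_zero, ← algebraMap_eq, AlgHom.commutes,
      Algebra.commutes]
  | add f g hf hg =>
    rw [sPoly_add, demazure_add, map_add, map_add, map_add, mul_add, add_mul, hf, hg]
    noncomm_ring
  | mul_X f r hf =>
    have hx : tau D Q β l * x D Q β r * e D Q ν =
        x D Q β (simpleSwap l r) * tau D Q β l * e D Q ν +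
          ofPoly D Q β (demazure l (X r)) * e D Q ν := by
      rw [tau_mul_x_mul_e]
      congr 1
      by_cases h1 : r = l.castSucc
      · rw [if_pos ⟨h1, h⟩, h1, demazure_X_castSucc]
        simp
      by_cases h2 : r = l.succ
      · rw [if_neg (by simp [h1]), if_pos ⟨h2, h⟩, h2, demazure_X_succ]
        simp
      · rw [if_neg (by simp [h1]), if_neg (by simp [h2]), demazure_X_of_ne h1 h2]
        simp
    calc tau D Q β l * ofPoly D Q β (f * X r) * e D Q ν
        = tau D Q β l * ofPoly D Q β f * e D Q ν * x D Q β r := by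
          rw [map_mul, ofPoly_X]
          simp only [mul_assoc]
          rw [x_mul_e]
      _ = ofPoly D Q β (sPoly l f) * (tau D Q β l * x D Q β r * e D Q ν) +
          ofPoly D Q β (demazure l f) * x D Q β r * e D Q ν := by
          rw [hf, add_mul]
          simp only [mul_assoc]
          rw [x_mul_e]
      _ = _ := by
          rw [hx, demazure_mul, sPoly_mul, sPoly_X, map_add, map_mul, map_mul, map_mul, ofPoly_X,
            ofPoly_X]
          noncomm_ring

theorem tau_mul_ofPoly_mul_e_of_ne {l : Fin n} {ν : D.Seq (n + 1) β}
    (h : ν l.castSucc ≠ ν l.succ) (f : MvPolynomial (Fin (n + 1)) k) :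
    tau D Q β l * ofPoly D Q β f * e D Q ν =
      ofPoly D Q β (sPoly l f) * tau D Q β l * e D Q ν := by
  induction f using MvPolynomial.induction_on with
  | C c => rw [sPoly_C, ← algebraMap_eq, AlgHom.commutes, Algebra.commutes]
  | add f g hf hg =>
    rw [sPoly_add, map_add, map_add, mul_add, add_mul, hf, hg, add_mul, add_mul]
  | mul_X f r hf =>
    have hx := tau_mul_x_mul_e (Q := Q) l r ν
    rw [if_neg (by simp [h]), if_neg (by simp [h]), add_zero] at hx
    calc tau D Q β l * ofPoly D Q β (f * X r) * e D Q ν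
        = tau D Q β l * ofPoly D Q β f * e D Q ν * x D Q β r := by
          rw [map_mul, ofPoly_X]
          simp only [mul_assoc]
          rw [x_mul_e]
      _ = ofPoly D Q β (sPoly l f) * (tau D Q β l * x D Q β r * e D Q ν) := by
          rw [hf]
          simp only [mul_assoc]
          rw [x_mul_e]
      _ = _ := by
          rw [hx, sPoly_mul, sPoly_X, map_mul, ofPoly_X]
          noncomm_ring

/-- An s_l-invariant polynomial has vanishing Demazure derivative, so the two colour cases agree. -/
theorem tau_mul_ofPoly_mul_e_of_sPoly_eq {l : Fin n} (ν : D.Seq (n + 1) β)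
    {f : MvPolynomial (Fin (n + 1)) k} (hf : sPoly l f = f) :
    tau D Q β l * ofPoly D Q β f * e D Q ν = ofPoly D Q β f * tau D Q β l * e D Q ν := by
  by_cases h : ν l.castSucc = ν l.succ
  · rw [tau_mul_ofPoly_mul_e_of_eq h, demazure_eq_zero hf, hf, map_zero, zero_mul, add_zero]
  · rw [tau_mul_ofPoly_mul_e_of_ne h, hf]

end Relations

/-! ### The commutative subalgebra and the error terms of the relations -/

section Base

variable (D Q n β) in
/-- The commutative subalgebra generated by the `x_r` and the `e(ν)`. -/
def base : Subalgebra k (KLRAlgebra D Q n β) :=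
  Algebra.adjoin k (Set.range (x D Q β) ∪ Set.range (e D Q))

theorem x_mem_base (r : Fin (n + 1)) : x D Q β r ∈ base D Q n β :=
  Algebra.subset_adjoin (Or.inl ⟨r, rfl⟩)

theorem e_mem_base (ν : D.Seq (n + 1) β) : e D Q ν ∈ base D Q n β :=
  Algebra.subset_adjoin (Or.inr ⟨ν, rfl⟩)

theorem ofPoly_mem_base (f : MvPolynomial (Fin (n + 1)) k) : ofPoly D Q β f ∈ base D Q n β := by
  induction f using MvPolynomial.induction_on with
  | C c =>
    rw [← algebraMap_eq, AlgHom.commutes]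
    exact Subalgebra.algebraMap_mem _ _
  | add f g hf hg =>
    rw [map_add]
    exact add_mem hf hg
  | mul_X f r hf =>
    rw [map_mul, ofPoly_X]
    exact mul_mem hf (x_mem_base r)

/-- On a single e(ν) every idempotent becomes 0 or 1, so only a polynomial remains. -/
theorem base_mul_e {b : KLRAlgebra D Q n β} (hb : b ∈ base D Q n β) (ν : D.Seq (n + 1) β) :
    ∃ f : MvPolynomial (Fin (n + 1)) k, b * e D Q ν = ofPoly D Q β f * e D Q ν := by
  induction hb using Algebra.adjoin_induction with
  | mem _ h =>
    rcases h with ⟨r, rfl⟩ | ⟨μ, rfl⟩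
    · exact ⟨X r, by rw [ofPoly_X]⟩
    · by_cases h : μ = ν
      · exact ⟨1, by rw [h, map_one, one_mul, e_mul_self]⟩
      · exact ⟨0, by rw [map_zero, zero_mul, e_mul_e h]⟩
  | algebraMap c => exact ⟨C c, by rw [← algebraMap_eq, AlgHom.commutes]⟩
  | add b b' _ _ h h' =>
    obtain ⟨f, hf⟩ := h
    obtain ⟨f', hf'⟩ := h'
    exact ⟨f + f', by rw [map_add, add_mul, add_mul, hf, hf']⟩
  | mul b b' _ _ h h' =>
    obtain ⟨f, hf⟩ := h
    obtain ⟨f', hf'⟩ := h'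
    refine ⟨f * f', ?_⟩
    rw [map_mul, mul_assoc, hf', ofPoly_mul_e, ← mul_assoc, hf, mul_assoc, ← ofPoly_mul_e,
      mul_assoc]

theorem base_mul_comm {b b' : KLRAlgebra D Q n β} (hb : b ∈ base D Q n β)
    (hb' : b' ∈ base D Q n β) : b * b' = b' * b := by
  have h : IsMulCommutative (base D Q n β) := Algebra.isMulCommutative_adjoin k <| by
    rintro _ (⟨r, rfl⟩ | ⟨ν, rfl⟩) _ (⟨s, rfl⟩ | ⟨μ, rfl⟩)
    · exact x_mul_x D Q β r s
    · exact x_mul_e r μ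
    · exact (x_mul_e s ν).symm
    · by_cases h : ν = μ
      · rw [h]
      · rw [e_mul_e h, e_mul_e (Ne.symm h)]
  exact congrArg Subtype.val (h.is_comm.comm ⟨b, hb⟩ ⟨b', hb'⟩)

theorem mul_sum_e (y : KLRAlgebra D Q n β) : ∑ ν : D.Seq (n + 1) β, y * e D Q ν = y := by
  rw [← Finset.mul_sum, sum_e, mul_one]

theorem tau_mul_x_sub_mem_base (l : Fin n) (r : Fin (n + 1)) :
    tau D Q β l * x D Q β r - x D Q β (simpleSwap l r) * tau D Q β l ∈ base D Q n β := by
  rw [← mul_sum_e (tau D Q β l * x D Q β r - x D Q β (simpleSwap l r) * tau D Q β l)]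
  refine sum_mem fun ν _ => ?_
  rw [sub_mul, tau_mul_x_mul_e, add_sub_cancel_left]
  split_ifs
  exacts [neg_mem (e_mem_base ν), e_mem_base ν, zero_mem _]

theorem tau_mul_tau_mem_base (l : Fin n) : tau D Q β l * tau D Q β l ∈ base D Q n β := by
  rw [← mul_sum_e (tau D Q β l * tau D Q β l)]
  refine sum_mem fun ν _ => ?_
  rw [tau_mul_tau_mul_e]
  exact mul_mem (ofPoly_mem_base _) (e_mem_base _)

theorem braid_mem_base {l m : Fin n} (hlm : (m : ℕ) = l + 1) :
    tau D Q β m * tau D Q β l * tau D Q β m - tau D Q β l * tau D Q β m * tau D Q β l ∈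
      base D Q n β := by
  rw [← mul_sum_e (tau D Q β m * tau D Q β l * tau D Q β m - _)]
  refine sum_mem fun ν _ => ?_
  rw [braid_mul_e hlm]
  split_ifs
  exacts [mul_mem (ofPoly_mem_base _) (e_mem_base _), zero_mem _]

theorem base_mul_tau {b : KLRAlgebra D Q n β} (hb : b ∈ base D Q n β) (l : Fin n) :
    ∃ b₁ ∈ base D Q n β, ∃ b₂ ∈ base D Q n β, b * tau D Q β l = tau D Q β l * b₁ + b₂ := by
  induction hb using Algebra.adjoin_induction with
  | mem _ h =>
    rcases h with ⟨r, rfl⟩ | ⟨μ, rfl⟩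
    · refine ⟨_, x_mem_base (simpleSwap l r), _,
        neg_mem (tau_mul_x_sub_mem_base l (simpleSwap l r)), ?_⟩
      rw [simpleSwap_simpleSwap]
      abel
    · exact ⟨_, e_mem_base _, 0, zero_mem _, by rw [e_mul_tau, add_zero]⟩
  | algebraMap c =>
    exact ⟨_, Subalgebra.algebraMap_mem _ c, 0, zero_mem _, by
      rw [Algebra.commutes, add_zero]⟩
  | add b b' _ _ h h' =>
    obtain ⟨b₁, h₁, b₂, h₂, e⟩ := h
    obtain ⟨b₁', h₁', b₂', h₂', e'⟩ := h'
    refine ⟨_, add_mem h₁ h₁', _, add_mem h₂ h₂', ?_⟩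
    rw [add_mul, e, e']
    noncomm_ring
  | mul b b' hb hb' h h' =>
    obtain ⟨b₁, h₁, b₂, h₂, e⟩ := h
    obtain ⟨b₁', h₁', b₂', h₂', e'⟩ := h'
    refine ⟨_, mul_mem h₁ h₁', _, add_mem (mul_mem h₂ h₁') (mul_mem hb h₂'), ?_⟩
    rw [mul_assoc, e', mul_add, ← mul_assoc, e]
    noncomm_ring

end Base

/-! ### Spanning by reduced words -/

section Spanning

theorem tauWord_append_singleton (L : List (Fin n)) (l : Fin n) :
    tauWord D Q β (L ++ [l]) = tauWord D Q β L * tau D Q β l := by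
  simp [tauWord]

theorem tauWord_mul_e (L : List (Fin n)) (ν : D.Seq (n + 1) β) :
    tauWord D Q β L * e D Q ν =
      e D Q (ν.act (L.map simpleSwap).prod) * tauWord D Q β L := by
  induction L with
  | nil => simp [tauWord, ν.act_one]
  | cons l L ih =>
    have h : tauWord D Q β (l :: L) = tau D Q β l * tauWord D Q β L := by simp [tauWord]
    rw [h, mul_assoc, ih, ← mul_assoc, tau_mul_e, List.map_cons, List.prod_cons,
      ν.act_mul, mul_assoc]

variable (D Q n β) in
/-- The span of the elements `τ_L b` for words `L` of length less than `m` and `b` in the base. -/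
def wordSpan (m : ℕ) : Submodule k (KLRAlgebra D Q n β) :=
  Submodule.span k {y | ∃ L : List (Fin n), L.length < m ∧ ∃ b ∈ base D Q n β,
    y = tauWord D Q β L * b}

theorem tauWord_mul_mem_wordSpan {L : List (Fin n)} {m : ℕ} (h : L.length < m)
    {b : KLRAlgebra D Q n β} (hb : b ∈ base D Q n β) :
    tauWord D Q β L * b ∈ wordSpan D Q n β m :=
  Submodule.subset_span ⟨L, h, b, hb, rfl⟩

theorem tauWord_mem_wordSpan {L : List (Fin n)} {m : ℕ} (h : L.length < m) :
    tauWord D Q β L ∈ wordSpan D Q n β m := by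
  simpa using tauWord_mul_mem_wordSpan (D := D) (Q := Q) (β := β) h (one_mem _)

theorem wordSpan_mono {m m' : ℕ} (h : m ≤ m') : wordSpan D Q n β m ≤ wordSpan D Q n β m' := by
  refine Submodule.span_mono ?_
  rintro _ ⟨L, hL, b, hb, rfl⟩
  exact ⟨L, hL.trans_le h, b, hb, rfl⟩

theorem mul_mem_of_span {s : Set (KLRAlgebra D Q n β)} {S : Submodule k (KLRAlgebra D Q n β)}
    {z y : KLRAlgebra D Q n β} (h : ∀ y ∈ s, y * z ∈ S) (hy : y ∈ Submodule.span k s) :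
    y * z ∈ S := by
  induction hy using Submodule.span_induction with
  | mem y hy => exact h y hy
  | zero => rw [zero_mul]; exact zero_mem _
  | add y y' _ _ hy hy' => rw [add_mul]; exact add_mem hy hy'
  | smul c y _ hy => rw [smul_mul_assoc]; exact S.smul_mem c hy

theorem wordSpan_mul_base {m : ℕ} {y b : KLRAlgebra D Q n β} (hy : y ∈ wordSpan D Q n β m)
    (hb : b ∈ base D Q n β) : y * b ∈ wordSpan D Q n β m := by
  refine mul_mem_of_span ?_ hy
  rintro _ ⟨L, hL, b', hb', rfl⟩
  rw [mul_assoc]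
  exact tauWord_mul_mem_wordSpan hL (mul_mem hb' hb)

theorem wordSpan_mul_tau {m : ℕ} {y : KLRAlgebra D Q n β} (hy : y ∈ wordSpan D Q n β m)
    (l : Fin n) : y * tau D Q β l ∈ wordSpan D Q n β (m + 1) := by
  refine mul_mem_of_span ?_ hy
  rintro _ ⟨L, hL, b, hb, rfl⟩
  obtain ⟨b₁, h₁, b₂, h₂, e⟩ := base_mul_tau hb l
  rw [mul_assoc, e, mul_add, ← mul_assoc, ← tauWord_append_singleton]
  exact add_mem (tauWord_mul_mem_wordSpan (by simpa using hL) h₁)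
    (tauWord_mul_mem_wordSpan (by omega) h₂)

/-- By Matsumoto's theorem it is enough to treat one commutation or braid move. Commutations are
exact, and a braid move has its error in `base`, which removes three letters. -/
theorem tauWord_sub_mem_wordSpan {L L' : List (Fin n)} {w : Equiv.Perm (Fin (n + 1))}
    (hL : IsReducedWord L w) (hL' : IsReducedWord L' w) :
    tauWord D Q β L - tauWord D Q β L' ∈ wordSpan D Q n β L.length := by
  -- Equality of lengths is part of the relation so that symmetry and transitivity stay at one
  -- filtration level.
  let R : List (Fin n) → List (Fin n) → Prop := fun L L' =>
    L.length = L'.length ∧ tauWord D Q β L - tauWord D Q β L' ∈ wordSpan D Q n β L.length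
  refine (IsReducedWord.rel (R := R) ⟨fun L => ⟨rfl, ?_⟩, fun h => ⟨h.1.symm, ?_⟩,
    fun h h' => ⟨h.1.trans h'.1, ?_⟩⟩ ?_ ?_ ?_ hL hL').2
  · rw [sub_self]
    exact zero_mem _
  · rw [← neg_sub, ← h.1]
    exact neg_mem h.2
  · rw [← sub_add_sub_cancel]
    exact add_mem h.2 (h.1 ▸ h'.2)
  · intro L L' l h
    refine ⟨by simp [h.1], ?_⟩
    rw [tauWord_append_singleton, tauWord_append_singleton, ← sub_mul, List.length_append]
    exact wordSpan_mul_tau h.2 l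
  · intro L s t hst
    refine ⟨by simp, ?_⟩
    simp only [tauWord_append_singleton, mul_assoc]
    rw [tau_mul_tau hst, sub_self]
    exact zero_mem _
  · intro L s t hst
    refine ⟨by simp, ?_⟩
    have h := neg_mem (braid_mem_base (D := D) (Q := Q) (β := β) hst)
    have e : tauWord D Q β (L ++ [s] ++ [t] ++ [s]) - tauWord D Q β (L ++ [t] ++ [s] ++ [t]) =
        tauWord D Q β L * -(tau D Q β t * tau D Q β s * tau D Q β t -
          tau D Q β s * tau D Q β t * tau D Q β s) := by
      simp only [tauWord_append_singleton]
      noncomm_ring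
    rw [e]
    exact tauWord_mul_mem_wordSpan (by simp) h

/-- At the first letter l that destroys reducedness, the prefix may be rewritten, up to shorter
words, to end in l itself; then τ_l² lies in `base` and two letters disappear. -/
theorem isReducedWord_or_tauWord_mem (L : List (Fin n)) :
    IsReducedWord L (L.map simpleSwap).prod ∨ tauWord D Q β L ∈ wordSpan D Q n β L.length := by
  induction L using List.reverseRecOn with
  | nil => exact Or.inl ⟨rfl, fun _ _ => Nat.zero_le _⟩
  | append_singleton L l ih =>
    rw [prod_map_append_singleton, tauWord_append_singleton, List.length_append]
    rcases ih with h | h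
    · rcases apply_lt_or_gt (L.map simpleSwap).prod l with hlt | hgt
      · exact Or.inl (h.append hlt)
      · right
        obtain ⟨M, hM⟩ := exists_isReducedWord ((L.map simpleSwap).prod * simpleSwap l)
        have hM' := hM.append_of_gt hgt
        have h1 := tauWord_sub_mem_wordSpan (D := D) (Q := Q) (β := β) h hM'
        have hlen : L.length = M.length + 1 := by
          have := (isReducedWord_iff.1 h).2.trans (isReducedWord_iff.1 hM').2.symm
          simpa using this
        have e : tauWord D Q β L * tau D Q β l =
            (tauWord D Q β L - tauWord D Q β (M ++ [l])) * tau D Q β l +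
              tauWord D Q β M * (tau D Q β l * tau D Q β l) := by
          rw [tauWord_append_singleton]
          noncomm_ring
        rw [e]
        refine add_mem (wordSpan_mul_tau h1 l)
          (tauWord_mul_mem_wordSpan (by simp [hlen]) (tau_mul_tau_mem_base l))
    · exact Or.inr (wordSpan_mul_tau h l)

theorem adjoin_generators : Algebra.adjoin k
    (Set.range (x D Q β) ∪ Set.range (e D Q) ∪ Set.range (tau D Q β) :
      Set (KLRAlgebra D Q n β)) = ⊤ := by
  have hs : Function.Surjective (mk D Q β (n := n)) := RingQuot.mkAlgHom_surjective k _
  rw [eq_top_iff, ← (AlgHom.range_eq_top _).2 hs, ← Algebra.map_top,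
    ← FreeAlgebra.adjoin_range_ι, AlgHom.map_adjoin]
  refine Algebra.adjoin_mono ?_
  rintro _ ⟨_, ⟨g, rfl⟩, rfl⟩
  cases g with
  | e ν => exact Or.inl (Or.inr ⟨ν, rfl⟩)
  | x r => exact Or.inl (Or.inl ⟨r, rfl⟩)
  | tau l => exact Or.inr ⟨l, rfl⟩

theorem mul_mem_of_generators {S : Submodule k (KLRAlgebra D Q n β)}
    (hb : ∀ y ∈ S, ∀ b ∈ base D Q n β, y * b ∈ S) (ht : ∀ y ∈ S, ∀ l, y * tau D Q β l ∈ S)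
    {y : KLRAlgebra D Q n β} (hy : y ∈ S) (z : KLRAlgebra D Q n β) : y * z ∈ S := by
  have hz : z ∈ Algebra.adjoin k
      (Set.range (x D Q β) ∪ Set.range (e D Q) ∪ Set.range (tau D Q β) :
        Set (KLRAlgebra D Q n β)) := by
    rw [adjoin_generators]
    exact Algebra.mem_top
  induction hz using Algebra.adjoin_induction generalizing y with
  | mem z h =>
    rcases h with h | ⟨l, rfl⟩
    · exact hb y hy z (Algebra.subset_adjoin h)
    · exact ht y hy l
  | algebraMap c => exact hb y hy _ (Subalgebra.algebraMap_mem _ c)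
  | add z z' _ _ h h' => rw [mul_add]; exact add_mem (h hy) (h' hy)
  | mul z z' _ _ h h' => rw [← mul_assoc]; exact h' (h hy)

variable {red : Equiv.Perm (Fin (n + 1)) → List (Fin n)}

theorem mem_span_reducedWords (hred : ∀ w, IsReducedWord (red w) w) (z : KLRAlgebra D Q n β) :
    z ∈ Submodule.span k {y : KLRAlgebra D Q n β | ∃ w, ∃ b ∈ base D Q n β,
      y = tauWord D Q β (red w) * b} := by
  set S : Submodule k (KLRAlgebra D Q n β) := Submodule.span k
    {y | ∃ w, ∃ b ∈ base D Q n β, y = tauWord D Q β (red w) * b} with hS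
  have hSb : ∀ y ∈ S, ∀ b ∈ base D Q n β, y * b ∈ S := by
    intro y hy b hb
    refine mul_mem_of_span ?_ hy
    rintro _ ⟨w, b', hb', rfl⟩
    exact Submodule.subset_span ⟨w, b' * b, mul_mem hb' hb, mul_assoc _ _ _⟩
  have hle : ∀ m, wordSpan D Q n β m ≤ S := by
    intro m
    induction m with
    | zero =>
      refine Submodule.span_le.2 ?_
      rintro _ ⟨L, hL, -⟩
      exact absurd hL (Nat.not_lt_zero _)
    | succ m ih =>
      refine Submodule.span_le.2 ?_
      rintro _ ⟨L, hL, b, hb, rfl⟩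
      refine hSb _ ?_ b hb
      have hm : wordSpan D Q n β L.length ≤ S := (wordSpan_mono (by omega)).trans ih
      rcases isReducedWord_or_tauWord_mem (D := D) (Q := Q) (β := β) L with h | h
      · have h1 := hm (tauWord_sub_mem_wordSpan h (hred _))
        rw [← sub_add_cancel (tauWord D Q β L) (tauWord D Q β (red (L.map simpleSwap).prod))]
        exact add_mem h1 (Submodule.subset_span ⟨_, 1, one_mem _, (mul_one _).symm⟩)
      · exact hm h
  have h1 : (1 : KLRAlgebra D Q n β) ∈ ⨆ m, wordSpan D Q n β m :=
    Submodule.mem_iSup_of_mem 1 (tauWord_mem_wordSpan (L := []) Nat.zero_lt_one)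
  have hdir : Directed (· ≤ ·) (wordSpan D Q n β) :=
    (monotone_nat_of_le_succ fun m => wordSpan_mono (Nat.le_succ m)).directed_le
  have h2 := mul_mem_of_generators (S := ⨆ m, wordSpan D Q n β m) ?_ ?_ h1 z
  · rw [one_mul] at h2
    exact (iSup_le hle) h2
  · intro y hy b hb
    obtain ⟨m, hm⟩ := (Submodule.mem_iSup_of_directed _ hdir).1 hy
    exact Submodule.mem_iSup_of_mem m (wordSpan_mul_base hm hb)
  · intro y hy l
    obtain ⟨m, hm⟩ := (Submodule.mem_iSup_of_directed _ hdir).1 hy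
    exact Submodule.mem_iSup_of_mem (m + 1) (wordSpan_mul_tau hm l)

/-- The left idempotent retains only those w that carry ν to μ. -/
theorem e_mul_mul_e_mem_span (hred : ∀ w, IsReducedWord (red w) w) (μ ν : D.Seq (n + 1) β)
    (z : KLRAlgebra D Q n β) :
    e D Q μ * z * e D Q ν ∈ Submodule.span k {y : KLRAlgebra D Q n β |
      ∃ (w : Equiv.Perm (Fin (n + 1))) (f : MvPolynomial (Fin (n + 1)) k), ν.act w = μ ∧
        y = tauWord D Q β (red w) * ofPoly D Q β f * e D Q ν} := by
  have hz := mem_span_reducedWords hred z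
  induction hz using Submodule.span_induction with
  | mem y hy =>
    obtain ⟨w, b, hb, rfl⟩ := hy
    obtain ⟨f, hf⟩ := base_mul_e hb ν
    have e1 : e D Q μ * (tauWord D Q β (red w) * b) * e D Q ν =
        e D Q μ * e D Q (ν.act w) * tauWord D Q β (red w) * ofPoly D Q β f := by
      have h := tauWord_mul_e (D := D) (Q := Q) (red w) ν
      rw [(hred w).1] at h
      rw [mul_assoc, mul_assoc, hf, ofPoly_mul_e, ← mul_assoc (tauWord D Q β (red w)), h]
      simp only [mul_assoc]
    rw [e1]
    by_cases h : ν.act w = μ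
    · refine Submodule.subset_span ⟨w, f, h, ?_⟩
      have h' := tauWord_mul_e (D := D) (Q := Q) (red w) ν
      rw [(hred w).1, h] at h'
      rw [h, e_mul_self, ← h', mul_assoc, mul_assoc, ofPoly_mul_e]
    · rw [e_mul_e (Ne.symm h), zero_mul, zero_mul]
      exact zero_mem _
  | zero => rw [mul_zero, zero_mul]; exact zero_mem _
  | add y y' _ _ h h' => rw [mul_add, add_mul]; exact add_mem h h'
  | smul c y _ h => rw [mul_smul_comm, smul_mul_assoc]; exact Submodule.smul_mem _ c h

end Spanning

end KLRAlgebra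

end QuiverHecke

end

noncomputable section

namespace QuiverHecke

open MvPolynomial

universe uI uP uK

/-! ### Colour order in block sequences -/

section BlockSequences

variable {I : Type uI} {p N : ℕ} {c : Fin p → I} {mult : Fin p → ℕ} {ν : Fin N → I}

theorem IsBlockSequence.exists_color (hν : IsBlockSequence c mult ν) (i : Fin N) :
    ∃ s, c s = ν i := by
  have h : ν i ∈ List.ofFn ν := (List.mem_ofFn' _ _).2 ⟨i, rfl⟩
  rw [hν, List.mem_flatMap] at h
  obtain ⟨s, -, hs⟩ := h
  exact ⟨s, (List.eq_of_mem_replicate hs).symm⟩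

theorem IsBlockSequence.lt_of_prec (hc : Function.Injective c) (hν : IsBlockSequence c mult ν)
    {i j : Fin N} (h : Prec c (ν i) (ν j)) : i < j := by
  have hp : (List.ofFn ν).Pairwise fun x y => ¬Prec c y x := by
    rw [hν, List.pairwise_flatMap]
    refine ⟨fun s _ => List.pairwise_replicate.2 (Or.inr ?_),
      (List.pairwise_lt_finRange p).imp ?_⟩
    · rintro ⟨t, u, ht, hu, htu⟩
      exact htu.ne (hc (ht.trans hu.symm))
    · rintro s t hst x hx y hy ⟨u, v, hu, hv, huv⟩
      rw [List.eq_of_mem_replicate hy] at hu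
      rw [List.eq_of_mem_replicate hx] at hv
      rw [hc hu, hc hv] at huv
      exact lt_asymm huv hst
  rw [List.pairwise_ofFn] at hp
  rcases lt_trichotomy i j with hij | rfl | hij
  · exact hij
  · obtain ⟨s, t, hs, ht, hst⟩ := h
    exact absurd (hc (hs.trans ht.symm)) hst.ne
  · exact absurd h (hp hij)

theorem Prec.asymm (hc : Function.Injective c) {i j : I} (h : Prec c i j) : ¬Prec c j i := by
  obtain ⟨s, t, rfl, rfl, hst⟩ := h
  rintro ⟨u, v, hu, hv, huv⟩
  rw [hc hu, hc hv] at huv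
  exact lt_asymm hst huv

end BlockSequences

namespace KLRAlgebra

variable {I : Type uI} {P : Type uP} [DecidableEq I] [AddCommGroup P]
  {k : Type uK} [CommRing k] [Finite I] {D : CartanDatum I P}
  {Q : I → I → MvPolynomial (Fin 2) k} {n : ℕ} {β : P}

/-! ### Moving g and its Demazure derivative past τ -/

section Commutation

variable {l : Fin n} {ν : D.Seq (n + 1) β}

theorem e_mul_tau_of_eq (h : ν l.castSucc = ν l.succ) :
    e D Q ν * tau D Q β l = tau D Q β l * e D Q ν := by
  rw [e_mul_tau, ν.act_simpleSwap_of_eq h]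

theorem demazure_mul_tau_mul_e (h : ν l.castSucc = ν l.succ) (hQ : ∀ i, Q i i = 0)
    (g : MvPolynomial (Fin (n + 1)) k) :
    ofPoly D Q β (demazure l g) * tau D Q β l * e D Q ν =
      tau D Q β l * ofPoly D Q β g * e D Q ν * tau D Q β l := by
  have h2 : tau D Q β l * (tau D Q β l * e D Q ν) = 0 := by
    rw [← mul_assoc, tau_mul_tau_mul_e, h, evalQ, hQ, map_zero, map_zero, zero_mul]
  rw [tau_mul_ofPoly_mul_e_of_eq h, add_mul]
  simp only [mul_assoc]
  rw [e_mul_tau_of_eq h, h2, mul_zero, zero_add]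

/-- In ∂_l(g) e = τ_l g e - s_l(g) τ_l e, substitute s_l(g) = g - (x_{l+1} - x_l) ∂_l(g) and then
`demazure_mul_tau_mul_e`. The result has g e(ν) in every term, followed by at most one τ_l; this is
the equal-colour case of L_{l+1} ⊆ L_l + L_l τ_l. -/
theorem demazure_mul_e (h : ν l.castSucc = ν l.succ) (hQ : ∀ i, Q i i = 0)
    (g : MvPolynomial (Fin (n + 1)) k) :
    ofPoly D Q β (demazure l g) * e D Q ν =
      tau D Q β l * ofPoly D Q β g * e D Q ν +
        (ofPoly D Q β (X l.succ - X l.castSucc) * tau D Q β l * ofPoly D Q β g * e D Q ν -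
          ofPoly D Q β g * e D Q ν) * tau D Q β l := by
  have h1 := demazure_mul_tau_mul_e h hQ g
  have h2 : ofPoly D Q β (sPoly l g) * tau D Q β l * e D Q ν =
      ofPoly D Q β g * (tau D Q β l * e D Q ν) - ofPoly D Q β (X l.succ - X l.castSucc) *
        (ofPoly D Q β (demazure l g) * tau D Q β l * e D Q ν) := by
    rw [sPoly_eq_sub, map_sub, map_mul]
    noncomm_ring
  rw [tau_mul_ofPoly_mul_e_of_eq h, h2, h1, ← e_mul_tau_of_eq h]
  noncomm_ring

/-- The commutation rule applied to s_l(g), with ∂_l(s_l(g)) = -∂_l(g). It writes g e(ν) τ_l using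
only left multiples of g e(ν) and ∂_l(g) e(ν). -/
theorem ofPoly_mul_e_mul_tau_of_eq (h : ν l.castSucc = ν l.succ)
    (g : MvPolynomial (Fin (n + 1)) k) :
    ofPoly D Q β g * e D Q ν * tau D Q β l =
      tau D Q β l * ofPoly D Q β g * e D Q ν +
        (1 - tau D Q β l * ofPoly D Q β (X l.succ - X l.castSucc)) *
          ofPoly D Q β (demazure l g) * e D Q ν := by
  have hd : demazure l (sPoly l g) = -demazure l g := by
    refine demazure_eq ?_
    rw [mul_neg, mul_demazure, sPoly_sPoly]
    ring
  have h1 := tau_mul_ofPoly_mul_e_of_eq (Q := Q) h (sPoly l g)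
  rw [sPoly_sPoly, hd, sPoly_eq_sub, map_sub, map_mul, map_neg] at h1
  rw [mul_assoc, e_mul_tau_of_eq h, ← mul_assoc, ← sub_eq_zero]
  rw [← sub_eq_zero] at h1
  rw [← neg_eq_zero, ← h1]
  noncomm_ring

theorem ofPoly_mul_e_mul_tau_of_ne (h : ν l.castSucc ≠ ν l.succ)
    (g : MvPolynomial (Fin (n + 1)) k) :
    ofPoly D Q β g * e D Q ν * tau D Q β l =
      tau D Q β l * ofPoly D Q β (sPoly l g) * e D Q (ν.act (simpleSwap l)) := by
  rw [tau_mul_ofPoly_mul_e_of_ne, sPoly_sPoly, mul_assoc, e_mul_tau, mul_assoc]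
  rw [ν.act_simpleSwap_apply, ν.act_simpleSwap_apply, simpleSwap_castSucc, simpleSwap_succ]
  exact h.symm

end Commutation

/-! ### Splitting off a crossing in front of a sorted sequence -/

section Sorting

variable {p : ℕ} {c : Fin p → I} {mult : Fin p → ℕ} {ν' : D.Seq (n + 1) β}

/-- Sorting an out-of-order pair l, l+1 forces w to have a descent at l, so the reduced word of w
can be chosen to end in l. As the two colours differ, polynomials then move across τ_l without an
error term. -/
theorem exists_tau_factor (hc : Function.Injective c) (hν' : IsBlockSequence c mult ν'.1)
    {l : Fin n} {ν : D.Seq (n + 1) β} (hne : ν l.castSucc ≠ ν l.succ)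
    (hp : ¬Prec c (ν l.castSucc) (ν l.succ)) (y : KLRAlgebra D Q n β) :
    ∃ y', e D Q ν' * y * e D Q ν = e D Q ν' * y' * tau D Q β l * e D Q ν := by
  have hdesc : ∀ w : Equiv.Perm (Fin (n + 1)), ν.act w = ν' → w l.succ < w l.castSucc := by
    intro w hw
    have h1 := ν.act_apply w l.castSucc
    have h2 := ν.act_apply w l.succ
    rw [hw] at h1 h2
    obtain ⟨s, hs⟩ := hν'.exists_color (w l.castSucc)
    obtain ⟨t, ht⟩ := hν'.exists_color (w l.succ)
    refine hν'.lt_of_prec hc ⟨t, s, ht, hs, ?_⟩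
    rw [h1] at hs
    rw [h2] at ht
    refine (lt_trichotomy s t).resolve_left (fun hst => hp ⟨s, t, hs, ht, hst⟩) |>.resolve_left ?_
    rintro rfl
    exact hne (hs.symm.trans ht)
  -- The choice of reduced words is adapted to ν and l; the spanning result allows any choice.
  have hex : ∀ w : Equiv.Perm (Fin (n + 1)), ∃ L : List (Fin n), IsReducedWord L w ∧
      (ν.act w = ν' → ∃ M, L = M ++ [l]) := by
    intro w
    by_cases hw : ν.act w = ν'
    · obtain ⟨M, hM⟩ := exists_isReducedWord (w * simpleSwap l)
      exact ⟨M ++ [l], hM.append_of_gt (hdesc w hw), fun _ => ⟨M, rfl⟩⟩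
    · obtain ⟨L, hL⟩ := exists_isReducedWord w
      exact ⟨L, hL, fun h => absurd h hw⟩
  choose red hred hlast using hex
  have key : ∃ y', e D Q ν' * y * e D Q ν = y' * tau D Q β l * e D Q ν := by
    have hz := e_mul_mul_e_mem_span (D := D) (Q := Q) hred ν' ν y
    generalize e D Q ν' * y * e D Q ν = z at hz
    induction hz using Submodule.span_induction with
    | mem y hy =>
      obtain ⟨w, f, hw, rfl⟩ := hy
      obtain ⟨M, hM⟩ := hlast w hw
      refine ⟨tauWord D Q β M * ofPoly D Q β (sPoly l f), ?_⟩
      have h := tau_mul_ofPoly_mul_e_of_ne (Q := Q) hne f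
      rw [hM, tauWord_append_singleton]
      simp only [mul_assoc] at h ⊢
      rw [h]
    | zero => exact ⟨0, by rw [zero_mul, zero_mul]⟩
    | add z z' _ _ h h' =>
      obtain ⟨y, hy⟩ := h
      obtain ⟨y', hy'⟩ := h'
      exact ⟨y + y', by rw [hy, hy', add_mul, add_mul]⟩
    | smul r z _ h =>
      obtain ⟨y, hy⟩ := h
      exact ⟨r • y, by rw [hy, smul_mul_assoc, smul_mul_assoc]⟩
  obtain ⟨y', hy'⟩ := key
  refine ⟨y', ?_⟩
  calc e D Q ν' * y * e D Q ν = e D Q ν' * (e D Q ν' * y * e D Q ν) := by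
        rw [← mul_assoc, ← mul_assoc, e_mul_self]
    _ = _ := by
        rw [hy']
        simp only [mul_assoc]

end Sorting

/-! ### The spans L_r and their right multiplication by τ -/

section LevelSpan

variable (Q) in
/-- The span of the elements `e(ν') y g_{μ,r} e(μ)`. -/
def levelSpan (a : I → Polynomial k) {p : ℕ} (c : Fin p → I) (ν' : D.Seq (n + 1) β)
    (r : Fin (n + 1)) : Submodule k (KLRAlgebra D Q n β) :=
  Submodule.span k {z | ∃ (y : KLRAlgebra D Q n β) (μ : D.Seq (n + 1) β),
    z = e D Q ν' * y * ofPoly D Q β (gPoly Q a c r μ.1) * e D Q μ}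

variable (Q) in
/-- The span of the elements `e(ν') y g_{μ,s} e(μ)` with `s ≤ r`. -/
def lowerSpan (a : I → Polynomial k) {p : ℕ} (c : Fin p → I) (ν' : D.Seq (n + 1) β)
    (r : Fin (n + 1)) : Submodule k (KLRAlgebra D Q n β) :=
  Submodule.span k {z | ∃ s ≤ r, ∃ (y : KLRAlgebra D Q n β) (μ : D.Seq (n + 1) β),
    z = e D Q ν' * y * ofPoly D Q β (gPoly Q a c s μ.1) * e D Q μ}

variable {a : I → Polynomial k} {p : ℕ} {c : Fin p → I} {ν' : D.Seq (n + 1) β}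

theorem mem_levelSpan (y : KLRAlgebra D Q n β) (μ : D.Seq (n + 1) β) (r : Fin (n + 1)) :
    e D Q ν' * y * ofPoly D Q β (gPoly Q a c r μ.1) * e D Q μ ∈ levelSpan Q a c ν' r :=
  Submodule.subset_span ⟨y, μ, rfl⟩

theorem levelSpan_le_lowerSpan {s r : Fin (n + 1)} (h : s ≤ r) :
    levelSpan Q a c ν' s ≤ lowerSpan Q a c ν' r := by
  refine Submodule.span_mono ?_
  rintro _ ⟨y, μ, rfl⟩
  exact ⟨s, h, y, μ, rfl⟩

theorem lowerSpan_mono {s r : Fin (n + 1)} (h : s ≤ r) :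
    lowerSpan Q a c ν' s ≤ lowerSpan Q a c ν' r := by
  refine Submodule.span_mono ?_
  rintro _ ⟨t, ht, y, μ, rfl⟩
  exact ⟨t, ht.trans h, y, μ, rfl⟩

theorem lowerSpan_mul_mem {r : Fin (n + 1)} {S : Submodule k (KLRAlgebra D Q n β)}
    {x : KLRAlgebra D Q n β} (h : ∀ s ≤ r, ∀ z ∈ levelSpan Q a c ν' s, z * x ∈ S)
    {z : KLRAlgebra D Q n β} (hz : z ∈ lowerSpan Q a c ν' r) : z * x ∈ S := by
  refine mul_mem_of_span ?_ hz
  rintro _ ⟨s, hs, y, μ, rfl⟩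
  exact h s hs _ (mem_levelSpan y μ s)

theorem levelSpan_mul_base {r : Fin (n + 1)} {z b : KLRAlgebra D Q n β}
    (hz : z ∈ levelSpan Q a c ν' r) (hb : b ∈ base D Q n β) : z * b ∈ levelSpan Q a c ν' r := by
  refine mul_mem_of_span ?_ hz
  rintro _ ⟨y, μ, rfl⟩
  have h : e D Q ν' * y * ofPoly D Q β (gPoly Q a c r μ.1) * e D Q μ * b =
      e D Q ν' * (y * b) * ofPoly D Q β (gPoly Q a c r μ.1) * e D Q μ := by
    have h1 := base_mul_comm (mul_mem (ofPoly_mem_base (gPoly Q a c r μ.1)) (e_mem_base μ)) hb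
    simp only [mul_assoc] at h1 ⊢
    rw [h1]
  rw [h]
  exact mem_levelSpan _ _ _

theorem lowerSpan_mul_base {r : Fin (n + 1)} {z b : KLRAlgebra D Q n β}
    (hz : z ∈ lowerSpan Q a c ν' r) (hb : b ∈ base D Q n β) : z * b ∈ lowerSpan Q a c ν' r :=
  lowerSpan_mul_mem (fun _ hs _ hz => levelSpan_le_lowerSpan hs (levelSpan_mul_base hz hb)) hz

/-- The polynomial g_{μ,r} involves only variables and colours up to position r, so τ_l beyond that
position commutes with it. -/
theorem levelSpan_mul_tau_of_lt {r : Fin (n + 1)} {l : Fin n} (h : r < l.castSucc)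
    {z : KLRAlgebra D Q n β} (hz : z ∈ levelSpan Q a c ν' r) :
    z * tau D Q β l ∈ levelSpan Q a c ν' r := by
  refine mul_mem_of_span ?_ hz
  rintro _ ⟨y, μ, rfl⟩
  have hg : gPoly Q a c r μ.1 = gPoly Q a c r (μ.act (simpleSwap l)).1 := by
    refine gPoly_congr fun s hs => ?_
    rw [μ.act_simpleSwap_apply, simpleSwap_of_ne (hs.trans_lt h).ne
      ((hs.trans_lt h).trans Fin.castSucc_lt_succ).ne]
  have hs : sPoly l (gPoly Q a c r μ.1) = gPoly Q a c r μ.1 :=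
    sPoly_of_mem_supported (by simpa using h)
      (by simpa using h.trans Fin.castSucc_lt_succ) (gPoly_mem_supported r μ.1)
  have e1 : e D Q ν' * y * ofPoly D Q β (gPoly Q a c r μ.1) * e D Q μ * tau D Q β l =
      e D Q ν' * (y * tau D Q β l) * ofPoly D Q β (gPoly Q a c r (μ.act (simpleSwap l)).1) *
        e D Q (μ.act (simpleSwap l)) := by
    have h2 := tau_mul_ofPoly_mul_e_of_sPoly_eq (Q := Q) (μ.act (simpleSwap l)) hs
    rw [← hg]
    simp only [mul_assoc] at h2 ⊢
    rw [e_mul_tau, h2]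
  rw [e1]
  exact mem_levelSpan _ _ _

theorem levelSpan_succ_decomp {mult : Fin p → ℕ} (hc : Function.Injective c)
    (hν' : IsBlockSequence c mult ν'.1) (hQ : ∀ i, Q i i = 0) {l : Fin n}
    {z : KLRAlgebra D Q n β} (hz : z ∈ levelSpan Q a c ν' l.succ) :
    ∃ z₁ ∈ levelSpan Q a c ν' l.castSucc, ∃ z₂ ∈ levelSpan Q a c ν' l.castSucc,
      z = z₁ + z₂ * tau D Q β l := by
  induction hz using Submodule.span_induction with
  | mem z hz =>
    obtain ⟨y, ν, rfl⟩ := hz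
    by_cases h : ν l.castSucc = ν l.succ
    · have h1 := demazure_mul_e (Q := Q) h hQ (gPoly Q a c l.castSucc ν.1)
      refine ⟨_, mem_levelSpan (y * tau D Q β l) ν _, _, sub_mem (mem_levelSpan
        (y * ofPoly D Q β (X l.succ - X l.castSucc) * tau D Q β l) ν _) (mem_levelSpan y ν _), ?_⟩
      rw [gPoly_succ_of_eq h, mul_assoc, h1]
      noncomm_ring
    have hact : permSeq (simpleSwap l) ν.1 = (ν.act (simpleSwap l)).1 := rfl
    have h2 := tau_mul_ofPoly_mul_e_of_ne (Q := Q) h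
      (sPoly l (gPoly Q a c l.castSucc (ν.act (simpleSwap l)).1))
    rw [sPoly_sPoly] at h2
    by_cases hp : Prec c (ν l.succ) (ν l.castSucc)
    -- The pair is out of order, so a τ_l is already available inside y to turn s_l(g) e(ν) into g
    -- e(s_l.ν) τ_l.
    · obtain ⟨y', hy'⟩ := exists_tau_factor (Q := Q) hc hν' h (hp.asymm hc) y
      refine ⟨0, zero_mem _, _, mem_levelSpan y' (ν.act (simpleSwap l)) _, ?_⟩
      rw [gPoly_succ_of_prec h hp, hact, zero_add, mul_assoc, ofPoly_mul_e, ← mul_assoc, hy']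
      rw [mul_assoc _ _ (ofPoly _ _ _ _), ← ofPoly_mul_e]
      simp only [mul_assoc] at h2 ⊢
      rw [h2, tau_mul_e]
    -- Here the factor Q in g_{ν,l+1} supplies τ_l², one copy staying on the left of g and the other
    -- passing to its right.
    · refine ⟨0, zero_mem _, _,
        mem_levelSpan (y * tau D Q β l) (ν.act (simpleSwap l)) _, ?_⟩
      have h3 := tau_mul_tau_mul_ofPoly_mul_e (Q := Q) l ν
        (sPoly l (gPoly Q a c l.castSucc (ν.act (simpleSwap l)).1))
      rw [gPoly_succ_of_not_prec h hp, hact, zero_add, mul_assoc, ← h3, h2]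
      simp only [mul_assoc]
      rw [tau_mul_e]
  | zero => exact ⟨0, zero_mem _, 0, zero_mem _, by rw [zero_mul, add_zero]⟩
  | add z z' _ _ h h' =>
    obtain ⟨z₁, h₁, z₂, h₂, hz⟩ := h
    obtain ⟨z₁', h₁', z₂', h₂', hz'⟩ := h'
    refine ⟨_, add_mem h₁ h₁', _, add_mem h₂ h₂', ?_⟩
    rw [hz, hz']
    noncomm_ring
  | smul r z _ h =>
    obtain ⟨z₁, h₁, z₂, h₂, hz⟩ := h
    refine ⟨_, Submodule.smul_mem _ r h₁, _, Submodule.smul_mem _ r h₂, ?_⟩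
    rw [hz, smul_add, smul_mul_assoc]

theorem levelSpan_mul_tau_castSucc {mult : Fin p → ℕ} (hc : Function.Injective c)
    (hν' : IsBlockSequence c mult ν'.1) {l : Fin n}
    {z : KLRAlgebra D Q n β} (hz : z ∈ levelSpan Q a c ν' l.castSucc) :
    z * tau D Q β l ∈ lowerSpan Q a c ν' l.succ := by
  have hle := levelSpan_le_lowerSpan (Q := Q) (a := a) (c := c) (ν' := ν')
    (Fin.castSucc_lt_succ (i := l)).le
  have hle' := levelSpan_le_lowerSpan (Q := Q) (a := a) (c := c) (ν' := ν') (le_refl l.succ)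
  refine mul_mem_of_span ?_ hz
  rintro _ ⟨y, ν, rfl⟩
  by_cases h : ν l.castSucc = ν l.succ
  · have h1 := ofPoly_mul_e_mul_tau_of_eq (Q := Q) h (gPoly Q a c l.castSucc ν.1)
    rw [← gPoly_succ_of_eq h] at h1
    have e1 : e D Q ν' * y * ofPoly D Q β (gPoly Q a c l.castSucc ν.1) * e D Q ν *
        tau D Q β l =
        e D Q ν' * (y * tau D Q β l) * ofPoly D Q β (gPoly Q a c l.castSucc ν.1) * e D Q ν +
        e D Q ν' * (y * (1 - tau D Q β l * ofPoly D Q β (X l.succ - X l.castSucc))) *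
          ofPoly D Q β (gPoly Q a c l.succ ν.1) * e D Q ν := by
      rw [mul_assoc, mul_assoc, ← mul_assoc (ofPoly _ _ _ _), h1]
      simp only [mul_add, mul_assoc]
    rw [e1]
    exact add_mem (hle (mem_levelSpan _ _ _)) (hle' (mem_levelSpan _ _ _))
  -- Multiplication by τ_l on the right ends at e(μ) with μ = s_l.ν, so it is the recursion for μ
  -- that must be matched.
  · obtain ⟨μ, rfl⟩ : ∃ μ : D.Seq (n + 1) β, ν = μ.act (simpleSwap l) :=
      ⟨_, (ν.act_simpleSwap_act l).symm⟩
    have hact : permSeq (simpleSwap l) μ.1 = (μ.act (simpleSwap l)).1 := rfl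
    have h1 := ofPoly_mul_e_mul_tau_of_ne (Q := Q) h
      (gPoly Q a c l.castSucc (μ.act (simpleSwap l)).1)
    rw [μ.act_simpleSwap_act] at h1
    have h0 := h
    rw [μ.act_simpleSwap_apply, μ.act_simpleSwap_apply, simpleSwap_castSucc,
      simpleSwap_succ] at h0
    replace h0 := Ne.symm h0
    by_cases hp : Prec c (μ l.succ) (μ l.castSucc)
    · rw [← hact, ← gPoly_succ_of_prec h0 hp, hact] at h1
      have e1 := congrArg (fun t => e D Q ν' * y * t) h1
      simp only [← mul_assoc] at e1
      rw [e1, mul_assoc (e D Q ν')]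
      exact hle' (mem_levelSpan _ _ _)
    -- Now s_l.μ is out of order: the τ_l extracted from y joins the one on the right, and τ_l²
    -- produces exactly the Q in g_{μ,l+1}.
    · obtain ⟨y', hy'⟩ := exists_tau_factor (Q := Q) hc hν' h
        (by rwa [μ.act_simpleSwap_apply, μ.act_simpleSwap_apply, simpleSwap_castSucc,
          simpleSwap_succ]) y
      have h3 := tau_mul_tau_mul_ofPoly_mul_e (Q := Q) l μ
        (sPoly l (gPoly Q a c l.castSucc (μ.act (simpleSwap l)).1))
      have e1 : e D Q ν' * y * ofPoly D Q β (gPoly Q a c l.castSucc (μ.act (simpleSwap l)).1) *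
          e D Q (μ.act (simpleSwap l)) * tau D Q β l =
          e D Q ν' * y' * ofPoly D Q β (gPoly Q a c l.succ μ.1) * e D Q μ := by
        rw [gPoly_succ_of_not_prec h0 hp, hact, mul_assoc (e D Q ν' * y'), ← h3, ← h1,
          mul_assoc (e D Q ν' * y), ofPoly_mul_e, ← mul_assoc, hy']
        simp only [mul_assoc]
      rw [e1]
      exact hle' (mem_levelSpan _ _ _)

/-- For equal colours ∂_l(g) is s_l-invariant and commutes with τ_l. For different colours τ_l
undoes the swap and leaves a multiple of g_{s_l.ν,l}. -/
theorem levelSpan_succ_mul_tau {l : Fin n}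
    {z : KLRAlgebra D Q n β} (hz : z ∈ levelSpan Q a c ν' l.succ) :
    z * tau D Q β l ∈ lowerSpan Q a c ν' l.succ := by
  have hle := levelSpan_le_lowerSpan (Q := Q) (a := a) (c := c) (ν' := ν')
    (Fin.castSucc_lt_succ (i := l)).le
  have hle' := levelSpan_le_lowerSpan (Q := Q) (a := a) (c := c) (ν' := ν') (le_refl l.succ)
  refine mul_mem_of_span ?_ hz
  rintro _ ⟨y, ν, rfl⟩
  by_cases h : ν l.castSucc = ν l.succ
  · have h1 := tau_mul_ofPoly_mul_e_of_sPoly_eq (Q := Q) ν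
      (sPoly_demazure l (gPoly Q a c l.castSucc ν.1))
    rw [← gPoly_succ_of_eq h, mul_assoc (ofPoly D Q β _) (tau D Q β l), ← e_mul_tau_of_eq h,
      ← mul_assoc] at h1
    rw [mul_assoc, mul_assoc, ← mul_assoc (ofPoly _ _ _ _), ← h1, ← mul_assoc, ← mul_assoc,
      mul_assoc (e D Q ν')]
    exact hle' (mem_levelSpan _ _ _)
  · have hact : permSeq (simpleSwap l) ν.1 = (ν.act (simpleSwap l)).1 := rfl
    have h1 := ofPoly_mul_e_mul_tau_of_ne (Q := Q) h (gPoly Q a c l.succ ν.1)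
    rw [mul_assoc, mul_assoc, ← mul_assoc (ofPoly _ _ _ _), h1]
    by_cases hp : Prec c (ν l.succ) (ν l.castSucc)
    · rw [gPoly_succ_of_prec h hp, hact, sPoly_sPoly, ← mul_assoc, ← mul_assoc,
        mul_assoc (e D Q ν')]
      exact hle (mem_levelSpan _ _ _)
    · rw [gPoly_succ_of_not_prec h hp, hact, sPoly_mul, sPoly_sPoly, mul_comm, map_mul,
        ← mul_assoc, ← mul_assoc, ← mul_assoc, mul_assoc (e D Q ν'), mul_assoc (e D Q ν')]
      exact hle (mem_levelSpan _ _ _)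

theorem lowerSpan_mul_tau_of_lt {r : Fin (n + 1)} {l : Fin n} (h : r < l.castSucc)
    {z : KLRAlgebra D Q n β} (hz : z ∈ lowerSpan Q a c ν' r) :
    z * tau D Q β l ∈ lowerSpan Q a c ν' r :=
  lowerSpan_mul_mem (fun _ hs _ hz =>
    levelSpan_le_lowerSpan hs (levelSpan_mul_tau_of_lt (hs.trans_lt h) hz)) hz

variable {mult : Fin p → ℕ}

theorem lowerSpan_castSucc_mul_tau (hc : Function.Injective c)
    (hν' : IsBlockSequence c mult ν'.1) {l : Fin n}
    {z : KLRAlgebra D Q n β} (hz : z ∈ lowerSpan Q a c ν' l.castSucc) :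
    z * tau D Q β l ∈ lowerSpan Q a c ν' l.succ := by
  refine lowerSpan_mul_mem (fun s hs z hz => ?_) hz
  rcases hs.lt_or_eq with hlt | rfl
  · exact levelSpan_le_lowerSpan (hs.trans Fin.castSucc_lt_succ.le)
      (levelSpan_mul_tau_of_lt hlt hz)
  · exact levelSpan_mul_tau_castSucc hc hν' hz

/-- Induction on the level. The new case is L_{m+1} τ_l with l < m: write the element as z₁ + z₂ τ_m
with z₁ and z₂ in L_m, and bring τ_l next to z₂ by commutation, or by the braid relation if m = l +
1. -/
theorem lowerSpan_mul_tau (hc : Function.Injective c) (hν' : IsBlockSequence c mult ν'.1)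
    (hQ : ∀ i, Q i i = 0) {r : Fin (n + 1)} {l : Fin n} (hl : l.succ ≤ r)
    {z : KLRAlgebra D Q n β} (hz : z ∈ lowerSpan Q a c ν' r) :
    z * tau D Q β l ∈ lowerSpan Q a c ν' r := by
  induction r using Fin.induction generalizing l z with
  | zero => exact absurd hl (not_le_of_gt (Fin.succ_pos l))
  | succ m ih =>
    have hle : lowerSpan Q a c ν' m.castSucc ≤ lowerSpan Q a c ν' m.succ :=
      lowerSpan_mono Fin.castSucc_lt_succ.le
    refine lowerSpan_mul_mem ?_ hz
    clear hz z
    intro s hs z hz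
    rcases (Fin.succ_le_succ_iff.1 hl).lt_or_eq with hlm | rfl
    · have hl' : l.succ ≤ m.castSucc := Fin.le_def.2 (by simpa using hlm)
      rcases hs.lt_or_eq with hlt | rfl
      · exact hle (ih hl' (levelSpan_le_lowerSpan (Fin.le_castSucc_iff.2 hlt) hz))
      · obtain ⟨z₁, h₁, z₂, h₂, rfl⟩ := levelSpan_succ_decomp hc hν' hQ hz
        rw [add_mul]
        refine add_mem (hle (ih hl' (levelSpan_le_lowerSpan le_rfl h₁))) ?_
        rcases Nat.lt_or_ge ((l : ℕ) + 1) m with hlm' | hlm'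
        · rw [mul_assoc, ← tau_mul_tau hlm', ← mul_assoc]
          exact lowerSpan_castSucc_mul_tau hc hν' (ih hl' (levelSpan_le_lowerSpan le_rfl h₂))
        · have hm : (m : ℕ) = l + 1 := by
            have : (l : ℕ) < m := hlm
            omega
          have e1 : m.castSucc = l.succ := by ext; simp [hm]
          have hlt : l.castSucc < m.castSucc := Fin.lt_def.2 (by simpa using hlm)
          have up {y : KLRAlgebra D Q n β} (hy : y ∈ lowerSpan Q a c ν' l.castSucc) :
              y * tau D Q β l ∈ lowerSpan Q a c ν' m.castSucc :=
            e1 ▸ lowerSpan_castSucc_mul_tau hc hν' hy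
          rw [e1] at h₂
          -- A second decomposition exposes τ_l τ_m τ_l after z₄ in L_l. Rewritten as τ_m τ_l τ_m,
          -- its first factor preserves L_{≤l} and the next two each raise the level by one; the
          -- braid error lies in `base`.
          obtain ⟨z₃, h₃, z₄, h₄, rfl⟩ := levelSpan_succ_decomp hc hν' hQ h₂
          have h₃' := lowerSpan_mul_tau_of_lt hlt (levelSpan_le_lowerSpan le_rfl h₃)
          have h₄' := lowerSpan_mul_tau_of_lt hlt (levelSpan_le_lowerSpan le_rfl h₄)
          have hb := levelSpan_mul_base h₄ (braid_mem_base (D := D) (Q := Q) (β := β) hm)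
          have e2 : (z₃ + z₄ * tau D Q β l) * tau D Q β m * tau D Q β l =
              z₃ * tau D Q β m * tau D Q β l +
                (z₄ * tau D Q β m * tau D Q β l * tau D Q β m -
                z₄ * (tau D Q β m * tau D Q β l * tau D Q β m -
                  tau D Q β l * tau D Q β m * tau D Q β l)) := by
            noncomm_ring
          rw [e2]
          exact add_mem (hle (up h₃')) (sub_mem (lowerSpan_castSucc_mul_tau hc hν' (up h₄'))
            (levelSpan_le_lowerSpan (hlt.le.trans Fin.castSucc_lt_succ.le) hb))
    · rcases hs.lt_or_eq with hlt | rfl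
      · exact lowerSpan_castSucc_mul_tau hc hν'
          (levelSpan_le_lowerSpan (Fin.le_castSucc_iff.2 hlt) hz)
      · exact levelSpan_succ_mul_tau hz

theorem lowerSpan_last_mul (hc : Function.Injective c) (hν' : IsBlockSequence c mult ν'.1)
    (hQ : ∀ i, Q i i = 0) {z : KLRAlgebra D Q n β}
    (hz : z ∈ lowerSpan Q a c ν' (Fin.last n)) (y : KLRAlgebra D Q n β) :
    z * y ∈ lowerSpan Q a c ν' (Fin.last n) :=
  mul_mem_of_generators (fun _ hz _ hb => lowerSpan_mul_base hz hb)
    (fun _ hz _ => lowerSpan_mul_tau hc hν' hQ (Fin.le_last _) hz) hz y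

end LevelSpan

/-! ### Comparison with the cyclotomic ideal -/

section CyclotomicIdeal

variable {a : I → Polynomial k} {p : ℕ} {c : Fin p → I} {ν' : D.Seq (n + 1) β}

theorem sum_aeval_mul_e_mul_e (ν : D.Seq (n + 1) β) :
    (∑ μ : D.Seq (n + 1) β, Polynomial.aeval (x D Q β (0 : Fin (n + 1))) (a (μ 0)) * e D Q μ) *
      e D Q ν = ofPoly D Q β (gPoly Q a c 0 ν.1) * e D Q ν := by
  rw [Finset.sum_mul, Finset.sum_eq_single ν]
  · rw [mul_assoc, e_mul_self, gPoly_zero, ← Polynomial.aeval_algHom_apply, ofPoly_X]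
  · intro μ _ h
    rw [mul_assoc, e_mul_e h, mul_zero]
  · exact fun h => absurd (Finset.mem_univ ν) h

variable {mult : Fin p → ℕ}

theorem levelSpan_le_cyclotomicIdeal (hc : Function.Injective c)
    (hν' : IsBlockSequence c mult ν'.1) (hQ : ∀ i, Q i i = 0) {r : Fin (n + 1)}
    {z : KLRAlgebra D Q n β} (hz : z ∈ levelSpan Q a c ν' r) :
    z ∈ cyclotomicIdeal D Q β a := by
  induction r using Fin.induction generalizing z with
  | zero =>
    induction hz using Submodule.span_induction with
    | mem z hz =>
      obtain ⟨y, μ, rfl⟩ := hz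
      rw [mul_assoc, ← sum_aeval_mul_e_mul_e]
      exact TwoSidedIdeal.mul_mem_left _ _ _ (TwoSidedIdeal.mul_mem_right _ _ _
        (TwoSidedIdeal.subset_span rfl))
    | zero => exact TwoSidedIdeal.zero_mem _
    | add z z' _ _ h h' => exact TwoSidedIdeal.add_mem _ h h'
    | smul r z _ h =>
      rw [Algebra.smul_def]
      exact TwoSidedIdeal.mul_mem_left _ _ _ h
  | succ l ih =>
    obtain ⟨z₁, h₁, z₂, h₂, rfl⟩ := levelSpan_succ_decomp hc hν' hQ hz
    exact TwoSidedIdeal.add_mem _ (ih h₁) (TwoSidedIdeal.mul_mem_right _ _ _ (ih h₂))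

/-- The ideal consists of sums of y · generator · y'. Inserting the sum of all e(ν) after the
generator puts e(ν') y · generator in L_1, and the right factor y' is absorbed because L_{≤n} is a
right ideal. -/
theorem e_mul_mem_lowerSpan (hc : Function.Injective c)
    (hν' : IsBlockSequence c mult ν'.1) (hQ : ∀ i, Q i i = 0) {z : KLRAlgebra D Q n β}
    (hz : z ∈ cyclotomicIdeal D Q β a) :
    e D Q ν' * z ∈ lowerSpan Q a c ν' (Fin.last n) := by
  rw [cyclotomicIdeal, TwoSidedIdeal.mem_span_iff_mem_addSubgroup_closure] at hz
  induction hz using AddSubgroup.closure_induction with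
  | mem z hz =>
    obtain ⟨_, ⟨y, -, _, rfl, rfl⟩, y', -, rfl⟩ := hz
    dsimp only
    rw [← mul_assoc]
    refine lowerSpan_last_mul hc hν' hQ ?_ y'
    rw [← mul_sum_e (e D Q ν' * _)]
    refine sum_mem fun ν _ => ?_
    rw [mul_assoc, mul_assoc, sum_aeval_mul_e_mul_e (c := c), ← mul_assoc, ← mul_assoc]
    exact levelSpan_le_lowerSpan (Fin.zero_le _) (mem_levelSpan y ν 0)
  | zero => rw [mul_zero]; exact zero_mem _
  | add z z' _ _ h h' => rw [mul_add]; exact add_mem h h'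
  | neg z _ h => rw [mul_neg]; exact neg_mem h

variable {red : Equiv.Perm (Fin (n + 1)) → List (Fin n)}

theorem smul_mem_of_opPoly {N : Submodule (MvPolynomial (Fin (n + 1)) k)ᵐᵒᵖ (KLRAlgebra D Q n β)}
    (r : k) {z : KLRAlgebra D Q n β} (hz : z ∈ N) : r • z ∈ N := by
  have h := N.smul_mem (MulOpposite.op (C r)) hz
  rwa [op_smul, ← algebraMap_eq, AlgHom.commutes, ← Algebra.commutes, ← Algebra.smul_def] at h

/-- Once y is expanded in reduced words, its polynomial coefficient stands beside g, commutes with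
it, and becomes the right scalar. -/
theorem lowerSpan_mul_e_mem (hred : ∀ w, IsReducedWord (red w) w) {r : Fin (n + 1)}
    {z : KLRAlgebra D Q n β} (hz : z ∈ lowerSpan Q a c ν' r) (ν : D.Seq (n + 1) β) :
    z * e D Q ν ∈ Submodule.span (MvPolynomial (Fin (n + 1)) k)ᵐᵒᵖ
      {y : KLRAlgebra D Q n β | ∃ (r : Fin (n + 1)) (w : Equiv.Perm (Fin (n + 1))),
        ν.act w = ν' ∧
        y = tauWord D Q β (red w) * ofPoly D Q β (gPoly Q a c r ν.1) * e D Q ν} := by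
  induction hz using Submodule.span_induction with
  | mem z hz =>
    obtain ⟨s, -, y, μ, rfl⟩ := hz
    by_cases h : μ = ν
    · subst h
      have h1 := e_mul_mul_e_mem_span (D := D) (Q := Q) hred ν' μ y
      rw [mul_assoc, e_mul_self, mul_assoc, ofPoly_mul_e, ← mul_assoc]
      generalize e D Q ν' * y * e D Q μ = z at h1
      induction h1 using Submodule.span_induction with
      | mem z hz =>
        obtain ⟨w, f, hw, rfl⟩ := hz
        have h2 := Submodule.smul_mem (Submodule.span (MvPolynomial (Fin (n + 1)) k)ᵐᵒᵖ
          {y : KLRAlgebra D Q n β | ∃ (r : Fin (n + 1)) (w : Equiv.Perm (Fin (n + 1))),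
            μ.act w = ν' ∧
            y = tauWord D Q β (red w) * ofPoly D Q β (gPoly Q a c r μ.1) * e D Q μ})
          (MulOpposite.op f) (Submodule.subset_span ⟨s, w, hw, rfl⟩)
        rw [op_smul, mul_assoc, ← ofPoly_mul_e, ← mul_assoc, mul_assoc (tauWord _ _ _ _),
          ← map_mul, mul_comm, map_mul] at h2
        rwa [mul_assoc, ← ofPoly_mul_e, ← mul_assoc, mul_assoc (tauWord _ _ _ _)]
      | zero => rw [zero_mul]; exact zero_mem _
      | add z z' _ _ h h' => rw [add_mul]; exact add_mem h h'
      | smul r z _ h => rw [smul_mul_assoc]; exact smul_mem_of_opPoly r h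
    · rw [mul_assoc, e_mul_e h, mul_zero]
      exact zero_mem _
  | zero => rw [zero_mul]; exact zero_mem _
  | add z z' _ _ h h' => rw [add_mul]; exact add_mem h h'
  | smul r z _ h => rw [smul_mul_assoc]; exact smul_mem_of_opPoly r h

theorem span_eq_e_mul_cyclotomicIdeal_mul_e (hc : Function.Injective c)
    (hν' : IsBlockSequence c mult ν'.1) (hQ : ∀ i, Q i i = 0)
    (hred : ∀ w, IsReducedWord (red w) w) (ν : D.Seq (n + 1) β) :
    ((Submodule.span (MvPolynomial (Fin (n + 1)) k)ᵐᵒᵖ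
      {y : KLRAlgebra D Q n β | ∃ (r : Fin (n + 1)) (w : Equiv.Perm (Fin (n + 1))),
        ν.act w = ν' ∧
        y = tauWord D Q β (red w) * ofPoly D Q β (gPoly Q a c r ν.1) * e D Q ν} :
      Submodule (MvPolynomial (Fin (n + 1)) k)ᵐᵒᵖ (KLRAlgebra D Q n β)) :
      Set (KLRAlgebra D Q n β)) =
    {y | ∃ z ∈ cyclotomicIdeal D Q β a, y = e D Q ν' * z * e D Q ν} := by
  ext y
  constructor
  · intro hy
    rw [SetLike.mem_coe] at hy
    induction hy using Submodule.span_induction with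
    | mem y hy =>
      obtain ⟨r, w, hw, rfl⟩ := hy
      -- Since w.ν = ν', the idempotent e(ν') may be inserted on the left.
      have e1 : tauWord D Q β (red w) * ofPoly D Q β (gPoly Q a c r ν.1) * e D Q ν =
          e D Q ν' * tauWord D Q β (red w) * ofPoly D Q β (gPoly Q a c r ν.1) * e D Q ν := by
        have h := tauWord_mul_e (D := D) (Q := Q) (red w) ν
        rw [(hred w).1, hw] at h
        rw [← h]
        simp only [mul_assoc]
        rw [ofPoly_mul_e, ← mul_assoc (e D Q ν), e_mul_self]
      refine ⟨_, levelSpan_le_cyclotomicIdeal hc hν' hQ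
        (mem_levelSpan (tauWord D Q β (red w)) ν r), ?_⟩
      simp only [← mul_assoc, e_mul_self]
      rw [mul_assoc _ (e D Q ν) (e D Q ν), e_mul_self, e1]
    | zero => exact ⟨0, TwoSidedIdeal.zero_mem _, by rw [mul_zero, zero_mul]⟩
    | add y y' _ _ h h' =>
      obtain ⟨z, hz, rfl⟩ := h
      obtain ⟨z', hz', rfl⟩ := h'
      exact ⟨z + z', TwoSidedIdeal.add_mem _ hz hz', by rw [mul_add, add_mul]⟩
    | smul f y _ h =>
      obtain ⟨z, hz, rfl⟩ := h
      refine ⟨z * ofPoly D Q β f.unop, TwoSidedIdeal.mul_mem_right _ _ _ hz, ?_⟩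
      rw [← MulOpposite.op_unop f, op_smul, MulOpposite.unop_op, mul_assoc, ← ofPoly_mul_e]
      simp only [mul_assoc]
  · rintro ⟨z, hz, rfl⟩
    exact lowerSpan_mul_e_mem hred (e_mul_mem_lowerSpan hc hν' hQ hz) ν

end CyclotomicIdeal

end KLRAlgebra

end QuiverHecke

end

theorem mainTheorem6
    {I P k : Type*} [Finite I] [DecidableEq I]
    [AddCommGroup P] [Module.Free ℤ P] [Module.Finite ℤ P]
    [CommRing k] (𝒜 : ℕ → AddSubgroup k) [GradedRing 𝒜]
    (D : CartanDatum I P)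
    (Q : I → I → MvPolynomial (Fin 2) k) (hQ : IsQMatrix D 𝒜 Q)
    (Λ : P) (hΛ : D.IsDominant Λ)
    (a : I → Polynomial k) (ha : IsCyclotomicFamily D 𝒜 Λ a)
    (n : ℕ) (β : P)
    (p : ℕ) (c : Fin p → I) (hc : Function.Injective c) (mult : Fin p → ℕ)
    (hβ : β = ∑ s, mult s • D.root (c s))
    (ν' : D.Seq (n + 1) β) (hν' : IsBlockSequence c mult ν')
    (red : Equiv.Perm (Fin (n + 1)) → List (Fin n)) (hred : ∀ w, IsReducedWord (red w) w)
    (ν : D.Seq (n + 1) β) :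
    (∀ r : Fin (n + 1),
      gPoly Q a c r ν ∈ MvPolynomial.supported k (Set.Iic r) ∧
      (HasUnitLeadingCoeff 𝒜 r (gPoly Q a c r ν) ∨
        (gPoly Q a c r ν = 0 ∧
          ∃ s < r, ∃ u : k, u ∈ 𝒜 0 ∧ IsUnit u ∧ gPoly Q a c s ν = MvPolynomial.C u))) ∧
    ((Submodule.span (MvPolynomial (Fin (n + 1)) k)ᵐᵒᵖ
        {y : KLRAlgebra D Q n β | ∃ (r : Fin (n + 1)) (w : Equiv.Perm (Fin (n + 1))),
          ν.act w = ν' ∧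
          y = KLRAlgebra.tauWord D Q β (red w) * KLRAlgebra.ofPoly D Q β (gPoly Q a c r ν) *
            KLRAlgebra.e D Q ν} : Submodule (MvPolynomial (Fin (n + 1)) k)ᵐᵒᵖ (KLRAlgebra D Q n β)) :
      Set (KLRAlgebra D Q n β)) =
    {y | ∃ z ∈ KLRAlgebra.cyclotomicIdeal D Q β a,
      y = KLRAlgebra.e D Q ν' * z * KLRAlgebra.e D Q ν} := by
  exact ⟨fun r => ⟨gPoly_mem_supported r ν.1, gPoly_leadingCoeff hQ ha r ν.1⟩,
    KLRAlgebra.span_eq_e_mul_cyclotomicIdeal_mul_e hc hν' hQ.diag hred ν⟩
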